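/- **Setting.** Let $k,m_f,m_g,n\ge 0$ be integers, $M\in\mathbb R^{n\times k}$, $\overline\mu\in\mathbb R^n$, $\lambda\ge 0$, $Q=U^{\mathsf T}U$ with $U\in\mathbb R^{n\times n}$ (for instance the Cholesky factorization of a positive semidefinite $Q$), $F\in\mathbb R^{m_f\times n}$ of full row rank, $f\in\mathbb R^{m_f}$, $G\in\mathbb R^{m_g\times n}$, $g\in\mathbb R^{m_g}$. Put $\mathcal X=\{x\in\mathbb R^n: Fx=f,\ Gx\le g\}$, $\mathcal U_\mu=\{\overline\mu+Mu:\|u\|_2\le 1\}$, $f_\mu(x)=\mu^{\mathsf T}x-\lambda x^{\mathsf T}Qx$, and $$R(x)=\sup_{\mu\in\mathcal U_\mu}\Bigl(\sup_{y\in\mathcal X}f_\mu(y)-f_\mu(x)\Bigr).$$ The relative robust problem (RRP) is $\min_{x\in\mathcal X}R(x)$. Let $x_p$ satisfy $Fx_p=f$, let $r=n-m_f$, and let the columns of $H\in\mathbb R^{n\times r}$ form a basis of $\ker F$. Put $$D=\{(u,y)\in\mathbb R^{k+n}:\ u^{\mathsf T}u\le 1,\ Fy=f,\ Gy\le g\},\qquad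 \mathscr M_{x,\gamma}=\begin{bmatrix}0&-\tfrac12M^{\mathsf T}&\tfrac12M^{\mathsf T}x\\-\tfrac12M&\lambda Q&-\tfrac12\overline\mu\\ \tfrac12x^{\mathsf T}M&-\tfrac12\overline\mu^{\mathsf T}&\gamma-\lambda x^{\mathsf T}Qx+\overline\mu^{\mathsf T}x\end{bmatrix}.$$ For a set $E\subseteq\mathbb R^N$ let $\mathscr{FC}_+(E)$ be the set of symmetric $(N+1)\times(N+1)$ matrices $A$ with $[x;1]^{\mathsf T}A[x;1]\ge 0$ for all $x\in E$, and $\mathscr H(E)=\operatorname{cl}\{[x;t]:t>0,\ t^{-1}x\in E\}$. Let $L_{N+1}=\{[\tau;u]\in\mathbb R^{1+N}:\|u\|_2\le\tau\}$, and in $\mathbb R^{k+r+1}$ let $p_0=[0;0;1]$ and $p_i=[0;-(GH)_i^{\mathsf T};(g-Gx_p)_i]$ for $i=1,\dots,m_g$, where $(GH)_i$ is the $i$-th row of $GH$. For $d\in\mathbb R^n$ and $\gamma,s,\eta,\xi_{ij},\tau_i\in\mathbb R$, $u_i\in\mathbb R^k$ let $$\begin{aligned}\mathcal L(d,\gamma,s,\eta,\xi,\tau,u)={}&\begin{bmatrix}0&-\tfrac12M^{\mathsf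 T}H&\tfrac12M^{\mathsf T}d\\-\tfrac12H^{\mathsf T}M&\lambda H^{\mathsf T}QH&H^{\mathsf T}(\lambda Qx_p-\tfrac12\overline\mu)\\ \tfrac12d^{\mathsf T}M&(\lambda Qx_p-\tfrac12\overline\mu)^{\mathsf T}H&\gamma-\lambda s+\overline\mu^{\mathsf T}d+\lambda x_p^{\mathsf T}Qx_p\end{bmatrix}-\eta\begin{bmatrix}-I_k&&\\&0_r&\\&&1\end{bmatrix}\\&-\sum_{i\ne j=0}^{m_g}\xi_{ij}\bigl(p_ip_j^{\mathsf T}+p_jp_i^{\mathsf T}\bigr)-\sum_{i=0}^{m_g}\Bigl(p_i[u_i;0;\tau_i]^{\mathsf T}+[u_i;0;\tau_i]\,p_i^{\mathsf T}\Bigr).\end{aligned}$$ Let $\mathrm{Sys}(x,\gamma)$ be the statement: there exist $s\in\mathbb R$, $\eta\ge 0$, $\xi_{ij}\ge 0$ $(i\ne j\in\{0,\dots,m_g\})$ and $[\tau_i;u_i]\in L_{k+1}$ $(i=0,\dots,m_g)$ with $$\begin{bmatrix}\tfrac1{\sqrt2}&\tfrac1{\sqrt2}&\\ \tfrac1{\sqrt2}&-\tfrac1{\sqrt2}&\\&&U\end{bmatrix}\begin{bmatrix}\tfrac12\\s\\x\end{bmatrix}\in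 L_{n+2}\quad(\ast)\qquad\text{and}\qquad \mathcal L(x-x_p,\gamma,s,\eta,\xi,\tau,u)\succeq 0 .$$ Let (ARRP) be the problem of minimizing $\gamma$ over all $(w,\gamma,s,\eta,\xi,\tau,u)$ (with $w\in\mathbb R^r$) subject to $g-Gx_p-GHw\ge 0$, $\eta\ge0$, $\xi_{ij}\ge 0$, $[\tau_i;u_i]\in L_{k+1}$, $$\begin{bmatrix}0\\0\\Ux_p\end{bmatrix}+\begin{bmatrix}\tfrac1{\sqrt2}&\tfrac1{\sqrt2}&\\ \tfrac1{\sqrt2}&-\tfrac1{\sqrt2}&\\&&UH\end{bmatrix}\begin{bmatrix}\tfrac12\\s\\w\end{bmatrix}\in L_{n+2},\qquad \mathcal L(Hw,\gamma,s,\eta,\xi,\tau,u)\succeq 0 .$$ **Claim.** 1. For all $x,\gamma$: $\mathscr M_{x,\gamma}\in\mathscr{FC}_+(D)$ if and only if $\mathscr M_{x,\gamma}\in\operatorname{conv}\{zz^{\mathsf T}:z\in\mathscr H(D)\}^*$ (dual cone in the symmetric matrices, for the trace inner product). 2. For all $x,s$: $(\ast)$ holds if and only if $s\ge x^{\mathsf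 T}Qx$. 3. For all $x\in\mathbb R^n$, $\gamma\in\mathbb R$: $\mathrm{Sys}(x,\gamma)$ implies $\mathscr M_{x,\gamma}\in\mathscr{FC}_+(D)$. 4. If $m_g\in\{0,1\}$, and if $\mathcal X\neq\emptyset$ or both $\lambda>0$ and $Q\succ0$, then for all $x,\gamma$: $\mathrm{Sys}(x,\gamma)$ if and only if $\mathscr M_{x,\gamma}\in\mathscr{FC}_+(D)$. 5. (ARRP) is a conic program: all its constraint expressions are affine functions of the decision variables, required to lie in $\mathbb R_+^{m_g}$, $\mathbb R_+$, $\mathbb R_+^{m_g(m_g+1)}$, $L_{k+1}$ ($m_g+1$ times), $L_{n+2}$ and the cone of positive semidefinite matrices of size $k+r+1$. 6. (ARRP) is an inner approximation of (RRP): if $(w,\gamma,s,\eta,\xi,\tau,u)$ is feasible for (ARRP), then $x=x_p+Hw$ satisfies $x\in\mathcal X$ and $R(x)\le\gamma$; hence the optimal value (infimum in $[-\infty,\infty]$) of (RRP) is at most that of (ARRP). 7. If $m_g\in\{0,1\}$, then (ARRP) is exact: for all $(x,\gamma)$, one has $x\in\mathcal X$ and $R(x)\le\gamma$ if and only if there is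 a feasible point of (ARRP) with this $\gamma$ and with $x_p+Hw=x$; and the optimal values of (ARRP) and (RRP) are equal. -/

import Mathlib

open Matrix

noncomputable section

namespace RelRobust

/-! ### Homogenization, copositivity cones, Lorentz cones -/

/-- The vector `[x; t]` with last component `t`. -/
def homVec {ι : Type*} (x : ι → ℝ) (t : ℝ) : ι ⊕ Unit → ℝ :=
  Sum.elim x (fun _ => t)

/-- The homogenization `cl {[x; t] : t > 0, t⁻¹ x ∈ D}` of a set `D`. -/
def homogenization {ι : Type*} (D : Set (ι → ℝ)) : Set (ι ⊕ Unit → ℝ) :=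
  closure {z | ∃ (x : ι → ℝ) (t : ℝ), z = homVec x t ∧ 0 < t ∧ t⁻¹ • x ∈ D}

/-- The matrix `[A b; bᵀ c]` representing the quadratic function `xᵀ A x + 2 bᵀ x + c`. -/
def quadMatrix {ι : Type*} (A : Matrix ι ι ℝ) (b : ι → ℝ) (c : ℝ) :
    Matrix (ι ⊕ Unit) (ι ⊕ Unit) ℝ :=
  fromBlocks A (replicateCol Unit b) (replicateRow Unit b) (of fun _ _ => c)

/-- The symmetric block matrix `[A₁₁ A₁₂ b₁; A₁₂ᵀ A₂₂ b₂; b₁ᵀ b₂ᵀ c]`. -/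
def quadMatrix₂ {κ ν : Type*} (A₁₁ : Matrix κ κ ℝ) (A₁₂ : Matrix κ ν ℝ) (A₂₂ : Matrix ν ν ℝ)
    (b₁ : κ → ℝ) (b₂ : ν → ℝ) (c : ℝ) : Matrix ((κ ⊕ ν) ⊕ Unit) ((κ ⊕ ν) ⊕ Unit) ℝ :=
  quadMatrix (fromBlocks A₁₁ A₁₂ A₁₂ᵀ A₂₂) (Sum.elim b₁ b₂) c

/-- The copositivity cone of `D`: matrices of the quadratic functions that are
nonnegative on `D`. -/
def copositivityCone {ι : Type*} [Fintype ι] (D : Set (ι → ℝ)) :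
    Set (Matrix (ι ⊕ Unit) (ι ⊕ Unit) ℝ) :=
  {A | A.IsSymm ∧ ∀ x ∈ D, 0 ≤ homVec x 1 ⬝ᵥ A *ᵥ homVec x 1}

/-- The dual cone of `C`, in the space of symmetric matrices, with respect to the trace
inner product. -/
def symDual {ι : Type*} [Fintype ι] (C : Set (Matrix ι ι ℝ)) : Set (Matrix ι ι ℝ) :=
  {A | A.IsSymm ∧ ∀ X ∈ C, 0 ≤ (Xᵀ * A).trace}

/-- The cone `conv {z zᵀ : z ∈ H(D)}*`. -/
def dualHullCone {ι : Type*} [Fintype ι] (D : Set (ι → ℝ)) :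
    Set (Matrix (ι ⊕ Unit) (ι ⊕ Unit) ℝ) :=
  symDual (convexHull ℝ {X | ∃ z ∈ homogenization D, X = vecMulVec z z})

/-- The second-order cone: vectors `[τ; u]` (the first component is indexed by `Unit`) with
`‖u‖₂ ≤ τ`. -/
def lorentzCone (ι : Type*) [Fintype ι] : Set (Unit ⊕ ι → ℝ) :=
  {v | √(∑ i, v (Sum.inr i) ^ 2) ≤ v (Sum.inl ())}

/-- The vector `[τ; u]` with first component `τ`. -/
def consVec {ι : Type*} (τ : ℝ) (u : ι → ℝ) : Unit ⊕ ι → ℝ :=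
  Sum.elim (fun _ => τ) u

/-- The matrix `[1/√2 1/√2 0; 1/√2 -1/√2 0; 0 0 V]`. -/
def socMatrix {ι κ : Type*} (V : Matrix ι κ ℝ) :
    Matrix (Unit ⊕ (Unit ⊕ ι)) (Unit ⊕ (Unit ⊕ κ)) ℝ :=
  fromBlocks (of fun _ _ => 1 / √2) (replicateRow Unit (consVec (1 / √2) 0))
    (replicateCol Unit (consVec (1 / √2) 0))
    (fromBlocks (of fun _ _ => -(1 / √2)) 0 0 V)

/-! ### The relative robust problem -/

/-- The data of a relative robust mean-variance problem: the ellipsoid `μ₀ + M u`, `‖u‖ ≤ 1`,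
the risk aversion `lam`, the covariance matrix `Q` with a factor `U`, the polyhedron
`F x = f`, `G x ≤ g`, a particular solution `xp` of `F x = f`, and a matrix `H` whose columns
parametrize `ker F`. -/
structure Data (n k mf mg r : ℕ) where
  M : Matrix (Fin n) (Fin k) ℝ
  μ₀ : Fin n → ℝ
  lam : ℝ
  Q : Matrix (Fin n) (Fin n) ℝ
  U : Matrix (Fin n) (Fin n) ℝ
  F : Matrix (Fin mf) (Fin n) ℝ
  f : Fin mf → ℝ
  G : Matrix (Fin mg) (Fin n) ℝ
  g : Fin mg → ℝ
  xp : Fin n → ℝ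
  H : Matrix (Fin n) (Fin r) ℝ

/-- Ordered pairs `(i, j)` with `i ≠ j` in `{0, …, m}`. -/
abbrev OffDiag (m : ℕ) : Type := {e : Fin (m + 1) × Fin (m + 1) // e.1 ≠ e.2}

/-- Index set of the matrices of size `k + r + 1`. -/
abbrev RedIdx (k r : ℕ) : Type := (Fin k ⊕ Fin r) ⊕ Unit

namespace Data

variable {n k mf mg r : ℕ} (P : Data n k mf mg r)

/-- The feasible portfolios. -/
def feasible : Set (Fin n → ℝ) := {x | P.F *ᵥ x = P.f ∧ P.G *ᵥ x ≤ P.g}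

/-- The ellipsoidal uncertainty set. -/
def ellipsoid : Set (Fin n → ℝ) := {μ | ∃ u : Fin k → ℝ, u ⬝ᵥ u ≤ 1 ∧ μ = P.μ₀ + P.M *ᵥ u}

/-- The objective `μᵀ x - lam * xᵀ Q x`. -/
def objective (μ x : Fin n → ℝ) : ℝ := μ ⬝ᵥ x - P.lam * (x ⬝ᵥ P.Q *ᵥ x)

/-- The optimal value for known `μ` (possibly infinite). -/
def optValue (μ : Fin n → ℝ) : EReal := ⨆ y ∈ P.feasible, (P.objective μ y : EReal)

/-- The maximal regret of `x` (possibly infinite). -/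
def maxRegret (x : Fin n → ℝ) : EReal :=
  ⨆ μ ∈ P.ellipsoid, (P.optValue μ - (P.objective μ x : EReal))

/-- The optimal value of the relative robust problem. -/
def rrpValue : EReal := ⨅ x ∈ P.feasible, P.maxRegret x

/-- The set of the vectors `[u; y]` with `uᵀ u ≤ 1`, `F y = f`, `G y ≤ g`. -/
def D : Set (Fin k ⊕ Fin n → ℝ) :=
  {v | ∃ (u : Fin k → ℝ) (y : Fin n → ℝ), v = Sum.elim u y ∧
    u ⬝ᵥ u ≤ 1 ∧ P.F *ᵥ y = P.f ∧ P.G *ᵥ y ≤ P.g}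

/-- The matrix of the quadratic function
`(u, y) ↦ γ - objective (μ₀ + M u) y + objective (μ₀ + M u) x`. -/
def regretMatrix (x : Fin n → ℝ) (γ : ℝ) :
    Matrix ((Fin k ⊕ Fin n) ⊕ Unit) ((Fin k ⊕ Fin n) ⊕ Unit) ℝ :=
  quadMatrix₂ 0 (-(1 / 2 : ℝ) • P.Mᵀ) (P.lam • P.Q)
    ((1 / 2 : ℝ) • P.Mᵀ *ᵥ x) (-(1 / 2 : ℝ) • P.μ₀)
    (γ - P.lam * (x ⬝ᵥ P.Q *ᵥ x) + P.μ₀ ⬝ᵥ x)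

/-! ### The second-order cone constraint and the linear matrix inequality -/

/-- The vectors `p₀ = [0; 0; 1]` and `pᵢ = [0; -(G H)ᵢ; (g - G xp)ᵢ]`, `i = 1, …, mg`. -/
def p : Fin (mg + 1) → RedIdx k r → ℝ :=
  Fin.cons (homVec (Sum.elim 0 0) 1)
    (fun i => homVec (Sum.elim 0 (-(P.G * P.H) i)) (P.g i - (P.G *ᵥ P.xp) i))

/-- The matrix `diag(-I, 0, 1)`. -/
def J (k r : ℕ) : Matrix (RedIdx k r) (RedIdx k r) ℝ := quadMatrix₂ (-1) 0 0 0 0 1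

/-- The left-hand side of the linear matrix inequality, where `d` stands for `x - xp`. -/
def lmi (d : Fin n → ℝ) (γ s η : ℝ) (ξ : OffDiag mg → ℝ) (τ : Fin (mg + 1) → ℝ)
    (u : Fin (mg + 1) → Fin k → ℝ) : Matrix (RedIdx k r) (RedIdx k r) ℝ :=
  quadMatrix₂ 0 (-(1 / 2 : ℝ) • (P.Mᵀ * P.H)) (P.lam • (P.Hᵀ * P.Q * P.H))
      ((1 / 2 : ℝ) • P.Mᵀ *ᵥ d)
      (P.Hᵀ *ᵥ (P.lam • P.Q *ᵥ P.xp - (1 / 2 : ℝ) • P.μ₀))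
      (γ - P.lam * s + P.μ₀ ⬝ᵥ d + P.lam * (P.xp ⬝ᵥ P.Q *ᵥ P.xp))
    - η • J k r
    - ∑ e : OffDiag mg, ξ e • (vecMulVec (P.p e.1.1) (P.p e.1.2)
        + vecMulVec (P.p e.1.2) (P.p e.1.1))
    - ∑ i, (vecMulVec (P.p i) (homVec (Sum.elim (u i) 0) (τ i))
        + vecMulVec (homVec (Sum.elim (u i) 0) (τ i)) (P.p i))

/-- The vector `[1/√2 1/√2 0; 1/√2 -1/√2 0; 0 0 U] [1/2; s; x]`. -/
def socVec (x : Fin n → ℝ) (s : ℝ) : Unit ⊕ (Unit ⊕ Fin n) → ℝ :=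
  socMatrix P.U *ᵥ consVec (1 / 2) (consVec s x)

/-- The explicit system: the second-order cone constraint and the linear matrix inequality
are solvable in `s, η, ξ, τ, u`. -/
def System (x : Fin n → ℝ) (γ : ℝ) : Prop :=
  ∃ (s η : ℝ) (ξ : OffDiag mg → ℝ) (τ : Fin (mg + 1) → ℝ) (u : Fin (mg + 1) → Fin k → ℝ),
    0 ≤ η ∧ (∀ e, 0 ≤ ξ e) ∧ (∀ i, consVec (τ i) (u i) ∈ lorentzCone (Fin k)) ∧
    P.socVec x s ∈ lorentzCone (Unit ⊕ Fin n) ∧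
    (P.lmi (x - P.xp) γ s η ξ τ u).PosSemidef

/-! ### The conic problem (ARRP) -/

/-- The decision variables `(w, γ, s, η, ξ, τ, u)`. -/
abbrev Var (k mg r : ℕ) : Type :=
  (Fin r → ℝ) × ℝ × ℝ × ℝ × (OffDiag mg → ℝ) × (Fin (mg + 1) → ℝ) × (Fin (mg + 1) → Fin k → ℝ)

/-- The space of the values of the constraint expressions. -/
abbrev ConSpace (n k mg r : ℕ) : Type :=
  (Fin mg → ℝ) × ℝ × (OffDiag mg → ℝ) × (Fin (mg + 1) → Unit ⊕ Fin k → ℝ) ×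
    (Unit ⊕ (Unit ⊕ Fin n) → ℝ) × Matrix (RedIdx k r) (RedIdx k r) ℝ

/-- The constraint expressions. -/
def arrpMap : Var k mg r → ConSpace n k mg r := fun (w, γ, s, η, ξ, τ, u) =>
  (P.g - P.G *ᵥ P.xp - (P.G * P.H) *ᵥ w,
   η,
   ξ,
   fun i => consVec (τ i) (u i),
   consVec 0 (consVec 0 (P.U *ᵥ P.xp))
     + socMatrix (P.U * P.H) *ᵥ consVec (1 / 2) (consVec s w),
   P.lmi (P.H *ᵥ w) γ s η ξ τ u)

/-- The product of nonnegative orthants, second-order cones and a cone of positive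
semidefinite matrices. -/
def arrpCone (n k mg r : ℕ) : Set (ConSpace n k mg r) :=
  {c | 0 ≤ c.1} ∩ {c | 0 ≤ c.2.1} ∩ {c | 0 ≤ c.2.2.1} ∩
    {c | ∀ i, c.2.2.2.1 i ∈ lorentzCone (Fin k)} ∩
    {c | c.2.2.2.2.1 ∈ lorentzCone (Unit ⊕ Fin n)} ∩
    {c | c.2.2.2.2.2.PosSemidef}

/-- The feasible set of (ARRP). -/
def arrpFeasible : Set (Var k mg r) := {v | P.arrpMap v ∈ arrpCone n k mg r}

/-- The optimal value of (ARRP): minimize `γ` over the feasible set. -/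
def arrpValue : EReal := ⨅ v ∈ P.arrpFeasible, (v.2.1 : EReal)

end Data

end RelRobust

end

noncomputable section

namespace RelRobust

/-! ### A relative S-lemma -/

section SLemma

variable {V : Type*} [AddCommGroup V] [Module ℝ V]

/-! The bound `R(x) ≤ γ` says that one quadratic function of `(u, y)` is nonnegative on the ball
times the polyhedron. Writing `y = xp + H w` and homogenizing turns this into nonnegativity of a
quadratic form in `z = (a, w, t)` on the cone `‖a‖ ≤ t`, `pᵢ · z ≥ 0`. On that cone `J(z) = t² -
‖a‖²`, the products `(pᵢ · z)(pⱼ · z)` and the products of `pᵢ · z` with functionals `(u, 0, τ)`,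
`‖u‖ ≤ τ`, are all nonnegative. Subtracting nonnegative multiples of them and asking for a positive
semidefinite remainder is therefore a certificate, whatever `mg` is. Replacing `xᵀ Q x` by some `s ≥
xᵀ Q x` only lowers the form, because `lam ≥ 0`.

Without inequalities the certificate exists by the S-lemma. With one inequality `p · z ≥ 0` whose
`w`-part is nonzero there are two stages. First, a version of the S-lemma relative to the halfspace
(`exists_multiplier`) yields `η` such that `A - η J` is nonnegative on the cut cone and also on the
whole hyperplane `p · z = 0`. Then `A - η J` is convex on the slice `p · z = 1` and nonnegative on
the part of the slice inside the cone. Hahn-Banach gives a linear minorant that is nonnegative on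
the cone (`exists_linear_minorant`). By self-duality of the Lorentz cone it has the form `(u, 0,
τ)`, and rescaling from the slice to all `z` gives the multiplier `p vᵀ + v pᵀ`
(`exists_lorentz_multiplier`).

If the `w`-part of `p` vanishes, the inequality is redundant or infeasible. Only the infeasible case
needs `lam > 0` and `Q ≻ 0`. -/

theorem bilin_add_smul {B : LinearMap.BilinForm ℝ V} (hB : ∀ x y, B x y = B y x) (z y : V)
    (θ : ℝ) : B (z + θ • y) (z + θ • y) = B z z + 2 * θ * B z y + θ ^ 2 * B y y := by
  simp only [map_add, map_smul, LinearMap.add_apply, LinearMap.smul_apply, smul_eq_mul, hB y z]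
  ring

/-- If `A` is nonnegative at the two zeros of `J` on the line `z + ℝ y`, where `J z > 0 > J y`,
then `A y / J y ≤ A z / J z`. -/
theorem mul_le_mul_of_nonneg_at_zeros {A J : LinearMap.BilinForm ℝ V}
    (hA : ∀ x y, A x y = A y x) (hJ : ∀ x y, J x y = J y x) {z y : V}
    (hz : 0 < J z z) (hy : J y y < 0)
    (h : ∀ θ : ℝ, J (z + θ • y) (z + θ • y) = 0 → 0 ≤ A (z + θ • y) (z + θ • y)) :
    A z z * J y y ≤ A y y * J z z := by
  simp only [bilin_add_smul hA, bilin_add_smul hJ] at h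
  set a := J y y
  set b := J z y
  set c := J z z
  have hΔ : b ^ 2 < b ^ 2 - a * c := by nlinarith
  set d := √(b ^ 2 - a * c)
  have hd : d ^ 2 = b ^ 2 - a * c := Real.sq_sqrt (by nlinarith)
  have hbd : |b| < d := Real.lt_sqrt_of_sq_lt (by rwa [sq_abs])
  obtain ⟨hb1, hb2⟩ := abs_lt.1 hbd
  have ha : a ≠ 0 := hy.ne
  -- The two evaluation points are the roots of `a θ² + 2 b θ + c`; they are real because `a c < 0`.
  have h1 := h ((-b + d) / a) (by field_simp; linear_combination hd)
  have h2 := h ((-b - d) / a) (by field_simp; linear_combination hd)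
  have e1 : 0 ≤ a ^ 2 * A z z + 2 * (a * (-b + d)) * A z y + (-b + d) ^ 2 * A y y := by
    have := mul_nonneg (sq_nonneg a) h1
    field_simp at this
    linarith
  have e2 : 0 ≤ a ^ 2 * A z z + 2 * (a * (-b - d)) * A z y + (-b - d) ^ 2 * A y y := by
    have := mul_nonneg (sq_nonneg a) h2
    field_simp at this
    linarith
  -- The weights `d + b` and `d - b` are positive because `|b| < d`, and they cancel the cross term
  -- `A z y`.
  have e3 : 0 ≤ (2 * d) * (-a) * (A y y * c - A z z * a) := by
    have t1 := mul_nonneg (by linarith : 0 ≤ b + d) e1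
    have t2 := mul_nonneg (by linarith : 0 ≤ d - b) e2
    have : (2 * d) * (-a) * (A y y * c - A z z * a)
        = (b + d) * (a ^ 2 * A z z + 2 * (a * (-b + d)) * A z y + (-b + d) ^ 2 * A y y)
        + (d - b) * (a ^ 2 * A z z + 2 * (a * (-b - d)) * A z y + (-b - d) ^ 2 * A y y) := by
      linear_combination (-(2 * d * A y y)) * hd
    linarith
  have hpos : 0 < (2 * d) * (-a) := by
    have : 0 < d := (abs_nonneg b).trans_lt hbd
    nlinarith
  linarith [nonneg_of_mul_nonneg_right e3 hpos]

/-- The multiplier is the infimum of `A z / J z` over the `z ∈ S` with `J z > 0`. It respects the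
bound on `S` by construction. For `y ∈ T` with `J y < 0`, every such ratio dominates `A y / J y`,
hence so does the infimum. The set `T` collects directions along which the zeros of `J` on a line
through `S` remain under control; membership in `S` of the whole line is not needed. -/
theorem exists_multiplier {A J : LinearMap.BilinForm ℝ V}
    (hA : ∀ x y, A x y = A y x) (hJ : ∀ x y, J x y = J y x) (S T : Set V)
    (hJS : ∀ z ∈ S, 0 ≤ J z z) (hAS : ∀ z ∈ S, 0 ≤ A z z)
    (hST : ∀ z ∈ S, 0 < J z z → ∀ y ∈ T, J y y < 0 → ∀ θ : ℝ,
      J (z + θ • y) (z + θ • y) = 0 → 0 ≤ A (z + θ • y) (z + θ • y))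
    (hne : ∃ z ∈ S, 0 < J z z) :
    ∃ η : ℝ, 0 ≤ η ∧ (∀ z ∈ S, η * J z z ≤ A z z) ∧
      ∀ y ∈ T, J y y < 0 → η * J y y ≤ A y y := by
  set R : Set ℝ := (fun z => A z z / J z z) '' {z | z ∈ S ∧ 0 < J z z} with hR
  have hRne : R.Nonempty := by
    obtain ⟨z, hz, hz'⟩ := hne
    exact ⟨_, z, ⟨hz, hz'⟩, rfl⟩
  have hR0 : ∀ ρ ∈ R, 0 ≤ ρ := by
    rintro _ ⟨z, ⟨hz, hz'⟩, rfl⟩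
    exact div_nonneg (hAS z hz) hz'.le
  have hbdd : BddBelow R := ⟨0, hR0⟩
  refine ⟨sInf R, le_csInf hRne hR0, fun z hz => ?_, fun y hy hy' => ?_⟩
  · rcases (hJS z hz).eq_or_lt with h | h
    · rw [← h, mul_zero]
      exact hAS z hz
    · exact (le_div_iff₀ h).1 (csInf_le hbdd ⟨z, ⟨hz, h⟩, rfl⟩)
  · rw [← div_le_iff_of_neg hy']
    refine le_csInf hRne ?_
    rintro _ ⟨z, ⟨hz, hz'⟩, rfl⟩
    rw [le_div_iff₀ hz', div_mul_eq_mul_div, div_le_iff_of_neg hy']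
    exact mul_le_mul_of_nonneg_at_zeros hA hJ hz' hy' (hST z hz hz' y hy hy')

/-- The S-lemma for two quadratic forms. -/
theorem exists_multiplier_of_nonneg {A J : LinearMap.BilinForm ℝ V}
    (hA : ∀ x y, A x y = A y x) (hJ : ∀ x y, J x y = J y x)
    (h : ∀ z, 0 ≤ J z z → 0 ≤ A z z) (hne : ∃ z, 0 < J z z) :
    ∃ η : ℝ, 0 ≤ η ∧ ∀ z, η * J z z ≤ A z z := by
  obtain ⟨η, h0, h1, h2⟩ := exists_multiplier hA hJ {z | 0 ≤ J z z} Set.univ (fun z hz => hz)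
    h (fun z _ _ y _ _ θ hθ => h _ hθ.ge) (by obtain ⟨z, hz⟩ := hne; exact ⟨z, hz.le, hz⟩)
  refine ⟨η, h0, fun z => ?_⟩
  rcases le_or_gt 0 (J z z) with hz | hz
  exacts [h1 z hz, h2 z trivial hz]

end SLemma

/-! ### Linear minorants of convex functions that are nonnegative on a cone -/

/-- The open strict epigraph of `φ` is disjoint from `L × (-∞, 0]`, so a hyperplane separates them.
It is not vertical, since the epigraph contains points above the origin, and its slope normalizes to
the minorant. -/
theorem exists_linear_minorant {E : Type*} [AddCommGroup E] [Module ℝ E] [TopologicalSpace E]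
    [IsTopologicalAddGroup E] [ContinuousSMul ℝ E] {φ : E → ℝ} (hφ : ConvexOn ℝ Set.univ φ)
    (hc : Continuous φ) {L : Set E} (hL : Convex ℝ L) (hL0 : (0 : E) ∈ L)
    (hLs : ∀ z ∈ L, ∀ c : ℝ, 0 ≤ c → c • z ∈ L) (h : ∀ z ∈ L, 0 ≤ φ z) :
    ∃ g : E →ₗ[ℝ] ℝ, (∀ z ∈ L, 0 ≤ g z) ∧ ∀ z, g z ≤ φ z := by
  set S : Set (E × ℝ) := {p | p.1 ∈ Set.univ ∧ φ p.1 < p.2}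
  set T : Set (E × ℝ) := L ×ˢ Set.Iic 0
  have hS : IsOpen S := by
    have : S = {p : E × ℝ | φ p.1 < p.2} := by ext; simp [S]
    rw [this]
    exact isOpen_lt (hc.comp continuous_fst) continuous_snd
  have hdisj : Disjoint S T := by
    rw [Set.disjoint_left]
    rintro ⟨z, ρ⟩ ⟨-, h1⟩ ⟨h2, h3⟩
    have := h z h2
    simp only [Set.mem_Iic] at h3
    simp only at h1
    linarith
  obtain ⟨F, c, hF1, hF2⟩ := geometric_hahn_banach_open hφ.convex_strict_epigraph hS
    (hL.prod (convex_Iic 0)) hdisj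
  set κ := F (0, 1)
  set g₀ : E →ₗ[ℝ] ℝ := F.toLinearMap ∘ₗ LinearMap.inl ℝ E ℝ
  have hF : ∀ z ρ, F (z, ρ) = g₀ z + ρ * κ := by
    intro z ρ
    have : ((z, ρ) : E × ℝ) = (z, 0) + ρ • ((0, 1) : E × ℝ) := by simp
    rw [this, map_add, map_smul]
    simp [g₀, κ]
  have h1 : ∀ z ρ, φ z < ρ → g₀ z + ρ * κ < c := fun z ρ hρ => by
    rw [← hF]; exact hF1 _ ⟨trivial, hρ⟩
  have h2 : ∀ z ∈ L, c ≤ g₀ z := fun z hz => by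
    have := hF2 (z, 0) ⟨hz, by simp⟩
    rwa [hF, zero_mul, add_zero] at this
  have hc0 : c ≤ 0 := by simpa using h2 0 hL0
  have hκ : κ < 0 := by
    have := h1 0 (φ 0 + 1) (by linarith)
    rw [map_zero, zero_add] at this
    have := h 0 hL0
    nlinarith
  have hg : ∀ z ∈ L, 0 ≤ g₀ z := by
    intro z hz
    by_contra! hneg
    -- This multiple of `z` stays in the cone and has value `c - 1`, below the lower bound `c`.
    have := h2 _ (hLs z hz ((c - 1) / g₀ z) (div_nonneg_of_nonpos (by linarith) hneg.le))
    rw [map_smul, smul_eq_mul, div_mul_cancel₀ _ hneg.ne] at this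
    linarith
  refine ⟨(-κ)⁻¹ • g₀, fun z hz => ?_, fun z => ?_⟩
  · rw [LinearMap.smul_apply, smul_eq_mul]
    exact mul_nonneg (inv_nonneg.2 (by linarith)) (hg z hz)
  · rw [LinearMap.smul_apply, smul_eq_mul, inv_mul_le_iff₀ (by linarith)]
    refine le_of_forall_pos_le_add fun ε hε => ?_
    have := h1 z (φ z + ε / (-κ)) (by have := div_pos hε (neg_pos.2 hκ); linarith)
    have e : ε / (-κ) * κ = -ε := by
      rw [div_neg, neg_mul, div_mul_cancel₀ _ hκ.ne]
    rw [add_mul, e] at this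
    linarith

/-! ### Evaluation of the quadratic forms -/

section Forms

variable {κ ν ι : Type*}

theorem exists_eq_homVec_elim (z : (κ ⊕ ν) ⊕ Unit → ℝ) :
    ∃ (a : κ → ℝ) (w : ν → ℝ) (t : ℝ), z = homVec (Sum.elim a w) t :=
  ⟨fun i => z (.inl (.inl i)), fun i => z (.inl (.inr i)), z (.inr ()), by
    ext ((i | i) | i) <;> rfl⟩

theorem homVec_add (x y : ι → ℝ) (s t : ℝ) :
    homVec x s + homVec y t = homVec (x + y) (s + t) := by
  ext (i | i) <;> rfl

theorem smul_homVec (c : ℝ) (x : ι → ℝ) (t : ℝ) :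
    c • homVec x t = homVec (c • x) (c * t) := by
  ext (i | i) <;> rfl

theorem sumElim_add (a b : κ → ℝ) (v w : ν → ℝ) :
    Sum.elim a v + Sum.elim b w = Sum.elim (a + b) (v + w) := by
  ext (i | i) <;> rfl

theorem smul_sumElim (c : ℝ) (a : κ → ℝ) (v : ν → ℝ) :
    c • Sum.elim a v = Sum.elim (c • a) (c • v) := by
  ext (i | i) <;> rfl

theorem homVec_dotProduct [Fintype ι] (x y : ι → ℝ) (s t : ℝ) :
    homVec x s ⬝ᵥ homVec y t = x ⬝ᵥ y + s * t := by
  simp [homVec, dotProduct]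

theorem homVec_elim_dotProduct [Fintype κ] [Fintype ν] (a b : κ → ℝ) (v w : ν → ℝ) (s t : ℝ) :
    homVec (Sum.elim a v) s ⬝ᵥ homVec (Sum.elim b w) t = a ⬝ᵥ b + v ⬝ᵥ w + s * t := by
  simp [homVec, dotProduct]

theorem quadMatrix_form [Fintype ι] (A : Matrix ι ι ℝ) (b : ι → ℝ) (c : ℝ) (x : ι → ℝ) (t : ℝ) :
    homVec x t ⬝ᵥ quadMatrix A b c *ᵥ homVec x t
      = x ⬝ᵥ A *ᵥ x + 2 * t * (b ⬝ᵥ x) + c * t ^ 2 := by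
  have h : quadMatrix A b c *ᵥ homVec x t = homVec (A *ᵥ x + t • b) (b ⬝ᵥ x + c * t) := by
    ext (i | i)
    · simp [quadMatrix, homVec, mulVec, dotProduct, mul_comm]
    · simp [quadMatrix, homVec, mulVec, dotProduct]
  rw [h, homVec_dotProduct, dotProduct_add, dotProduct_smul, dotProduct_comm x b, smul_eq_mul]
  ring

theorem quadMatrix₂_form [Fintype κ] [Fintype ν] (A₁₁ : Matrix κ κ ℝ) (A₁₂ : Matrix κ ν ℝ)
    (A₂₂ : Matrix ν ν ℝ) (b₁ : κ → ℝ) (b₂ : ν → ℝ) (c : ℝ) (a : κ → ℝ) (w : ν → ℝ) (t : ℝ) :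
    homVec (Sum.elim a w) t ⬝ᵥ quadMatrix₂ A₁₁ A₁₂ A₂₂ b₁ b₂ c *ᵥ homVec (Sum.elim a w) t
      = a ⬝ᵥ A₁₁ *ᵥ a + 2 * (a ⬝ᵥ A₁₂ *ᵥ w) + w ⬝ᵥ A₂₂ *ᵥ w
        + 2 * t * (b₁ ⬝ᵥ a + b₂ ⬝ᵥ w) + c * t ^ 2 := by
  rw [quadMatrix₂, quadMatrix_form, fromBlocks_mulVec, Sum.elim_comp_inl, Sum.elim_comp_inr,
    sumElim_dotProduct_sumElim, sumElim_dotProduct_sumElim, dotProduct_add, dotProduct_add, mulVec_transpose,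
    dotProduct_comm w (a ᵥ* A₁₂), ← dotProduct_mulVec]
  ring

theorem quadMatrix_isSymm {A : Matrix ι ι ℝ} (hA : A.IsSymm) (b : ι → ℝ) (c : ℝ) :
    (quadMatrix A b c).IsSymm := by
  rw [quadMatrix, isSymm_fromBlocks_iff]
  exact ⟨hA, rfl, rfl, rfl⟩

theorem quadMatrix₂_isSymm {A₁₁ : Matrix κ κ ℝ} (h₁ : A₁₁.IsSymm) (A₁₂ : Matrix κ ν ℝ)
    {A₂₂ : Matrix ν ν ℝ} (h₂ : A₂₂.IsSymm) (b₁ : κ → ℝ) (b₂ : ν → ℝ) (c : ℝ) :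
    (quadMatrix₂ A₁₁ A₁₂ A₂₂ b₁ b₂ c).IsSymm :=
  quadMatrix_isSymm (isSymm_fromBlocks_iff.2 ⟨h₁, rfl, transpose_transpose _, h₂⟩) _ _

theorem quadMatrix₂_add (A₁₁ A₁₁' : Matrix κ κ ℝ) (A₁₂ A₁₂' : Matrix κ ν ℝ)
    (A₂₂ A₂₂' : Matrix ν ν ℝ) (b₁ b₁' : κ → ℝ) (b₂ b₂' : ν → ℝ) (c c' : ℝ) :
    quadMatrix₂ A₁₁ A₁₂ A₂₂ b₁ b₂ c + quadMatrix₂ A₁₁' A₁₂' A₂₂' b₁' b₂' c'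
      = quadMatrix₂ (A₁₁ + A₁₁') (A₁₂ + A₁₂') (A₂₂ + A₂₂') (b₁ + b₁') (b₂ + b₂') (c + c') := by
  ext ((i | i) | i) ((j | j) | j) <;> rfl

theorem smul_quadMatrix₂ (ρ : ℝ) (A₁₁ : Matrix κ κ ℝ) (A₁₂ : Matrix κ ν ℝ)
    (A₂₂ : Matrix ν ν ℝ) (b₁ : κ → ℝ) (b₂ : ν → ℝ) (c : ℝ) :
    ρ • quadMatrix₂ A₁₁ A₁₂ A₂₂ b₁ b₂ c
      = quadMatrix₂ (ρ • A₁₁) (ρ • A₁₂) (ρ • A₂₂) (ρ • b₁) (ρ • b₂) (ρ * c) := by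
  ext ((i | i) | i) ((j | j) | j) <;> rfl

theorem vecMulVec_form [Fintype ι] (p v z : ι → ℝ) :
    z ⬝ᵥ vecMulVec p v *ᵥ z = (p ⬝ᵥ z) * (v ⬝ᵥ z) := by
  rw [vecMulVec_mulVec, dotProduct_smul, op_smul_eq_mul, dotProduct_comm z p]

theorem vecMulVec_add_swap_form [Fintype ι] (p v z : ι → ℝ) :
    z ⬝ᵥ (vecMulVec p v + vecMulVec v p) *ᵥ z = 2 * ((p ⬝ᵥ z) * (v ⬝ᵥ z)) := by
  rw [add_mulVec, dotProduct_add, vecMulVec_form, vecMulVec_form]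
  ring

theorem vecMulVec_add_swap_isSymm (p v : ι → ℝ) :
    (vecMulVec p v + vecMulVec v p).IsSymm := by
  rw [IsSymm, transpose_add, transpose_vecMulVec, transpose_vecMulVec, add_comm]

theorem J_form {k r : ℕ} (a : Fin k → ℝ) (w : Fin r → ℝ) (t : ℝ) :
    homVec (Sum.elim a w) t ⬝ᵥ Data.J k r *ᵥ homVec (Sum.elim a w) t = t ^ 2 - a ⬝ᵥ a := by
  rw [Data.J, quadMatrix₂_form]
  simp [neg_mulVec]
  ring

theorem J_isSymm (k r : ℕ) : (Data.J k r).IsSymm :=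
  quadMatrix₂_isSymm (by simp [IsSymm]) _ (by simp [IsSymm]) _ _ _

theorem isSymm_toBilin' [Fintype ι] [DecidableEq ι] {A : Matrix ι ι ℝ} (hA : A.IsSymm)
    (x y : ι → ℝ) : toBilin' A x y = toBilin' A y x := by
  rw [toBilin'_apply', toBilin'_apply', dotProduct_mulVec, dotProduct_comm, ← mulVec_transpose,
    hA.eq]

end Forms

/-! ### Lorentz cones -/

theorem mem_lorentzCone_consVec {ι : Type*} [Fintype ι] {τ : ℝ} {u : ι → ℝ} :
    consVec τ u ∈ lorentzCone ι ↔ 0 ≤ τ ∧ u ⬝ᵥ u ≤ τ ^ 2 := by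
  have h : (∑ i, consVec τ u (Sum.inr i) ^ 2) = u ⬝ᵥ u := by
    simp [consVec, dotProduct, sq]
  change √(∑ i, consVec τ u (Sum.inr i) ^ 2) ≤ τ ↔ _
  rw [h, Real.sqrt_le_iff]

theorem dotProduct_sq_le {ι : Type*} [Fintype ι] (u v : ι → ℝ) :
    (u ⬝ᵥ v) ^ 2 ≤ (u ⬝ᵥ u) * (v ⬝ᵥ v) := by
  have := Finset.sum_mul_sq_le_sq_mul_sq Finset.univ u v
  simpa [dotProduct, sq] using this

theorem dotProduct_self_nonneg' {ι : Type*} [Fintype ι] (u : ι → ℝ) : 0 ≤ u ⬝ᵥ u :=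
  Finset.sum_nonneg fun i _ => mul_self_nonneg (u i)

/-- The Lorentz cone pairs nonnegatively with itself. -/
theorem dotProduct_add_mul_nonneg {ι : Type*} [Fintype ι] {u a : ι → ℝ} {τ t : ℝ}
    (hτ : 0 ≤ τ) (hu : u ⬝ᵥ u ≤ τ ^ 2) (ht : 0 ≤ t) (ha : a ⬝ᵥ a ≤ t ^ 2) :
    0 ≤ u ⬝ᵥ a + τ * t := by
  have h1 : (u ⬝ᵥ a) ^ 2 ≤ (τ * t) ^ 2 := by
    rw [mul_pow]
    exact (dotProduct_sq_le u a).trans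
      (mul_le_mul hu ha (dotProduct_self_nonneg' a) (sq_nonneg τ))
  have := (abs_le_of_sq_le_sq' h1 (mul_nonneg hτ ht)).1
  linarith

theorem convex_cylinder (κ ν : Type*) [Fintype κ] : Convex ℝ {z : (κ ⊕ ν) ⊕ Unit → ℝ |
    ∃ (a : κ → ℝ) (w : ν → ℝ) (t : ℝ), z = homVec (Sum.elim a w) t ∧ 0 ≤ t ∧ a ⬝ᵥ a ≤ t ^ 2} := by
  rintro _ ⟨a, w, t, rfl, ht, ha⟩ _ ⟨b, v, s, rfl, hs, hb⟩ α β hα hβ -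
  refine ⟨α • a + β • b, α • w + β • v, α * t + β * s, ?_, by positivity, ?_⟩
  · simp only [smul_homVec, smul_sumElim, homVec_add, sumElim_add]
  · have h1 : (a ⬝ᵥ b) ^ 2 ≤ (t * s) ^ 2 := by
      rw [mul_pow]
      exact (dotProduct_sq_le a b).trans
        (mul_le_mul ha hb (dotProduct_self_nonneg' b) (sq_nonneg t))
    have h2 := (abs_le_of_sq_le_sq' h1 (mul_nonneg ht hs)).2
    simp only [add_dotProduct, dotProduct_add, smul_dotProduct, dotProduct_smul, smul_eq_mul,
      dotProduct_comm b a]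
    have h3 := mul_le_mul_of_nonneg_left ha (sq_nonneg α)
    have h4 := mul_le_mul_of_nonneg_left hb (sq_nonneg β)
    have h5 := mul_le_mul_of_nonneg_left h2 (mul_nonneg hα hβ)
    nlinarith

/-- A point with `|t| < |b|` cannot move an interior point of the Lorentz cone to the boundary of
the opposite cone. -/
theorem nonneg_of_on_boundary {ι : Type*} [Fintype ι] {a b : ι → ℝ} {t s θ : ℝ}
    (ht : 0 ≤ t) (ha : a ⬝ᵥ a < t ^ 2) (hb : s ^ 2 < b ⬝ᵥ b)
    (h : (a + θ • b) ⬝ᵥ (a + θ • b) ≤ (t + θ * s) ^ 2) : 0 ≤ t + θ * s := by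
  by_contra! hneg
  have key : 0 ≤ (a + θ • b) ⬝ᵥ a + (-(t + θ * s)) * t :=
    dotProduct_add_mul_nonneg (by linarith) (by rwa [neg_sq]) ht ha.le
  simp only [add_dotProduct, dotProduct_add, smul_dotProduct, dotProduct_smul, smul_eq_mul,
    dotProduct_comm b a] at h key
  -- With `Z = (a, t)`, `Y = (b, s)`: `J(Z + θY) ≥ 0` by `h` and `J(Z + θY, Z) ≤ 0` by `key`, while
  -- `J(Z + θY) - 2 J(Z + θY, Z) = θ² J(Y) - J(Z)`.
  have h7 : θ ^ 2 * (b ⬝ᵥ b - s ^ 2) ≤ 0 := by nlinarith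
  have h8 : θ = 0 := by
    by_contra hθ
    exact absurd h7 (not_le.2 (mul_pos (by positivity) (by linarith)))
  rw [h8, zero_mul] at hneg
  linarith

/-! ### Quadratic forms that are nonnegative on a second-order cone cut by a halfspace -/

section Copositive

variable {k r : ℕ}

/-- Quadratic forms are even, so nonnegativity on the forward cone extends to the double cone `J ≥
0`, where the S-lemma applies. -/
theorem exists_multiplier_J {A : Matrix (RedIdx k r) (RedIdx k r) ℝ} (hA : A.IsSymm)
    (h : ∀ (a : Fin k → ℝ) (w : Fin r → ℝ) (t : ℝ), 0 ≤ t → a ⬝ᵥ a ≤ t ^ 2 →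
      0 ≤ homVec (Sum.elim a w) t ⬝ᵥ A *ᵥ homVec (Sum.elim a w) t) :
    ∃ η : ℝ, 0 ≤ η ∧ ∀ z, η * (z ⬝ᵥ Data.J k r *ᵥ z) ≤ z ⬝ᵥ A *ᵥ z := by
  have hcone : ∀ z, 0 ≤ z ⬝ᵥ Data.J k r *ᵥ z → 0 ≤ z ⬝ᵥ A *ᵥ z := by
    intro z hz
    obtain ⟨a, w, t, rfl⟩ := exists_eq_homVec_elim z
    rw [J_form] at hz
    rcases le_total 0 t with ht | ht
    · exact h a w t ht (by linarith)
    · have := h (-a) (-w) (-t) (by linarith) (by simpa using hz)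
      have e : homVec (Sum.elim (-a) (-w)) (-t) = -homVec (Sum.elim a w) t := by
        ext ((i | i) | i) <;> rfl
      rwa [e, mulVec_neg, neg_dotProduct_neg] at this
  simp only [← toBilin'_apply'] at hcone ⊢
  exact exists_multiplier_of_nonneg (isSymm_toBilin' hA) (isSymm_toBilin' (J_isSymm k r)) hcone
    ⟨homVec (Sum.elim 0 0) 1, by rw [toBilin'_apply', J_form]; simp⟩

/-- Let `A` be nonnegative where `‖a‖ ≤ t` and `0 ≤ p`, and positive semidefinite where `p = 0`.
Then `A - p vᵀ - v pᵀ` is positive semidefinite for some `v` in the dual cone of `‖a‖ ≤ t`. -/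
theorem exists_lorentz_multiplier {A : Matrix (RedIdx k r) (RedIdx k r) ℝ} (hA : A.IsSymm)
    {p z₀ : RedIdx k r → ℝ} {w₀ : Fin r → ℝ} (hz₀ : z₀ = homVec (Sum.elim 0 w₀) 0)
    (hp : p ⬝ᵥ z₀ = 1) (hker : ∀ z, p ⬝ᵥ z = 0 → 0 ≤ z ⬝ᵥ A *ᵥ z)
    (h : ∀ (a : Fin k → ℝ) (w : Fin r → ℝ) (t : ℝ), 0 ≤ t → a ⬝ᵥ a ≤ t ^ 2 →
      0 ≤ p ⬝ᵥ homVec (Sum.elim a w) t →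
      0 ≤ homVec (Sum.elim a w) t ⬝ᵥ A *ᵥ homVec (Sum.elim a w) t) :
    ∃ (τ : ℝ) (u : Fin k → ℝ), consVec τ u ∈ lorentzCone (Fin k) ∧
      ∀ z, 2 * ((p ⬝ᵥ z) * (homVec (Sum.elim u 0) τ ⬝ᵥ z)) ≤ z ⬝ᵥ A *ᵥ z := by
  set L := {z : RedIdx k r → ℝ | ∃ (a : Fin k → ℝ) (w : Fin r → ℝ) (t : ℝ),
    z = homVec (Sum.elim a w) t ∧ 0 ≤ t ∧ a ⬝ᵥ a ≤ t ^ 2}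
  -- The form is composed with the projection onto `p = 1` along `z₀`. Differences of projected
  -- points lie in `p = 0`, where the form is nonnegative; this gives convexity.
  have hconv : ConvexOn ℝ Set.univ fun z : RedIdx k r → ℝ =>
      (z + (1 - p ⬝ᵥ z) • z₀) ⬝ᵥ A *ᵥ (z + (1 - p ⬝ᵥ z) • z₀) := by
    refine ⟨convex_univ, fun x _ y _ α β hα hβ hαβ => ?_⟩
    simp only [smul_eq_mul, ← toBilin'_apply']
    have hS := isSymm_toBilin' hA
    have e : α • x + β • y + (1 - p ⬝ᵥ (α • x + β • y)) • z₀
        = α • (x + (1 - p ⬝ᵥ x) • z₀) + β • (y + (1 - p ⬝ᵥ y) • z₀) := by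
      simp only [dotProduct_add, dotProduct_smul, smul_eq_mul]
      rw [show β = 1 - α by linarith]
      module
    have hd : p ⬝ᵥ ((x + (1 - p ⬝ᵥ x) • z₀) - (y + (1 - p ⬝ᵥ y) • z₀)) = 0 := by
      simp only [dotProduct_sub, dotProduct_add, dotProduct_smul, smul_eq_mul, hp]
      ring
    have := hker _ hd
    rw [← toBilin'_apply'] at this
    rw [e]
    set X := x + (1 - p ⬝ᵥ x) • z₀
    set Y := y + (1 - p ⬝ᵥ y) • z₀
    simp only [map_add, map_sub, map_smul, LinearMap.add_apply, LinearMap.sub_apply,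
      LinearMap.smul_apply, smul_eq_mul, hS Y X] at this ⊢
    have hβ' : β = 1 - α := by linarith
    have := mul_nonneg (mul_nonneg hα hβ) this
    rw [hβ'] at this ⊢
    nlinarith
  obtain ⟨g, hg1, hg2⟩ := exists_linear_minorant hconv (by fun_prop) (convex_cylinder _ _)
    (L := L) ⟨0, 0, 0, by ext ((i | i) | i) <;> rfl, le_rfl, by simp⟩ (by
      rintro _ ⟨a, w, t, rfl, ht, ha⟩ c hc
      refine ⟨c • a, c • w, c * t, by simp only [smul_homVec, smul_sumElim], by positivity, ?_⟩
      simp only [smul_dotProduct, dotProduct_smul, smul_eq_mul]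
      have := mul_le_mul_of_nonneg_left ha (sq_nonneg c)
      linarith) (by
      rintro _ ⟨a, w, t, rfl, ht, ha⟩
      -- Moving along `z₀` changes only `w`, so the projected point keeps `‖a‖ ≤ t` and satisfies `p
      -- = 1 ≥ 0`.
      have hd : p ⬝ᵥ (homVec (Sum.elim a w) t + (1 - p ⬝ᵥ homVec (Sum.elim a w) t) • z₀) = 1 := by
        simp only [dotProduct_add, dotProduct_smul, smul_eq_mul, hp]
        ring
      generalize 1 - p ⬝ᵥ homVec (Sum.elim a w) t = c at hd ⊢
      rw [hz₀, smul_homVec, smul_sumElim, homVec_add, sumElim_add, smul_zero, add_zero, mul_zero,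
        add_zero] at hd ⊢
      exact h _ _ _ ht ha (by rw [hd]; exact zero_le_one))
  obtain ⟨u, ω, τ, hv⟩ := exists_eq_homVec_elim
    (fun i => g (Pi.single i 1) : RedIdx k r → ℝ)
  have hg : ∀ z, g z = homVec (Sum.elim u ω) τ ⬝ᵥ z := by
    intro z
    rw [← hv, LinearMap.pi_apply_eq_sum_univ g z]
    simp only [dotProduct, smul_eq_mul, mul_comm]
    refine Finset.sum_congr rfl fun i _ => ?_
    congr 2
    ext j
    simp [Pi.single_apply, eq_comm]
  have hgL : ∀ (a : Fin k → ℝ) (w : Fin r → ℝ) (t : ℝ), 0 ≤ t → a ⬝ᵥ a ≤ t ^ 2 →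
      0 ≤ u ⬝ᵥ a + ω ⬝ᵥ w + τ * t := fun a w t ht ha => by
    rw [← homVec_elim_dotProduct, ← hg]
    exact hg1 _ ⟨a, w, t, rfl, ht, ha⟩
  -- The cone contains every `(0, w, 0)`, so the minorant cannot depend on `w`.
  have hω : ω = 0 := by
    have := hgL 0 (-ω) 0 le_rfl (by simp)
    have h2 := dotProduct_self_nonneg' ω
    simp only [dotProduct_zero, dotProduct_neg, mul_zero] at this
    exact dotProduct_self_eq_zero.1 (by linarith)
  have hτ : 0 ≤ τ := by simpa using hgL 0 0 1 zero_le_one (by simp)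
  have hu : u ⬝ᵥ u ≤ τ ^ 2 := by
    have hs := Real.sq_sqrt (dotProduct_self_nonneg' u)
    -- Testing with `a = -u`, `t = ‖u‖` is the extremal case that yields `‖u‖ ≤ τ`.
    have := hgL (-u) 0 (√(u ⬝ᵥ u)) (Real.sqrt_nonneg _) (by simp [hs])
    simp only [dotProduct_neg, dotProduct_zero] at this
    have h3 : √(u ⬝ᵥ u) ≤ τ := by
      rcases (Real.sqrt_nonneg (u ⬝ᵥ u)).eq_or_lt with h0 | h0
      · rwa [← h0]
      · nlinarith
    exact (Real.sqrt_le_left hτ).1 h3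
  subst hω
  -- The minorant is halved because the symmetrized product contributes a factor `2`.
  refine ⟨τ / 2, (1 / 2 : ℝ) • u, mem_lorentzCone_consVec.2 ⟨by positivity, ?_⟩, fun z => ?_⟩
  · simp only [smul_dotProduct, dotProduct_smul, smul_eq_mul]
    linarith
  · have e : homVec (Sum.elim ((1 / 2 : ℝ) • u) (0 : Fin r → ℝ)) (τ / 2)
        = (1 / 2 : ℝ) • homVec (Sum.elim u 0) τ := by
      rw [smul_homVec, smul_sumElim, smul_zero]
      congr 1
      ring
    rw [e, smul_dotProduct, smul_eq_mul, ← hg]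
    by_cases hz : p ⬝ᵥ z = 0
    · rw [hz]
      simpa using hker z hz
    -- On the slice point `z / (p · z)` the projection is the identity; multiplying by `(p · z)²`
    -- gives `(p · z) g(z) ≤ A(z)` for either sign of `p · z`.
    · have h1 := hg2 ((p ⬝ᵥ z)⁻¹ • z)
      simp only [dotProduct_smul, smul_eq_mul, inv_mul_cancel₀ hz, sub_self, zero_smul, add_zero,
        map_smul, mulVec_smul, smul_dotProduct] at h1
      have h2 := mul_le_mul_of_nonneg_left h1 (sq_nonneg (p ⬝ᵥ z))
      have e1 : (p ⬝ᵥ z) ^ 2 * ((p ⬝ᵥ z)⁻¹ * g z) = (p ⬝ᵥ z) * g z := by field_simp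
      have e2 : (p ⬝ᵥ z) ^ 2 * ((p ⬝ᵥ z)⁻¹ * ((p ⬝ᵥ z)⁻¹ * (z ⬝ᵥ A *ᵥ z))) = z ⬝ᵥ A *ᵥ z := by
        field_simp
      linarith

/-- The condition `b ≠ 0` enters twice: it provides a point of `p = 0` with `J > 0`, and a pure
`w`-direction on which `p` equals `1`. -/
theorem exists_multipliers_of_halfspace {A : Matrix (RedIdx k r) (RedIdx k r) ℝ} (hA : A.IsSymm)
    {p : RedIdx k r → ℝ} {b : Fin r → ℝ} {c : ℝ} (hp : p = homVec (Sum.elim 0 b) c) (hb : b ≠ 0)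
    (h : ∀ (a : Fin k → ℝ) (w : Fin r → ℝ) (t : ℝ), 0 ≤ t → a ⬝ᵥ a ≤ t ^ 2 →
      0 ≤ p ⬝ᵥ homVec (Sum.elim a w) t →
      0 ≤ homVec (Sum.elim a w) t ⬝ᵥ A *ᵥ homVec (Sum.elim a w) t) :
    ∃ (η τ : ℝ) (u : Fin k → ℝ), 0 ≤ η ∧ consVec τ u ∈ lorentzCone (Fin k) ∧
      ∀ z, η * (z ⬝ᵥ Data.J k r *ᵥ z) + 2 * ((p ⬝ᵥ z) * (homVec (Sum.elim u 0) τ ⬝ᵥ z))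
        ≤ z ⬝ᵥ A *ᵥ z := by
  have hbb : b ⬝ᵥ b ≠ 0 := fun h0 => hb (dotProduct_self_eq_zero.1 h0)
  have hpz : ∀ (a : Fin k → ℝ) w t, p ⬝ᵥ homVec (Sum.elim a w) t = b ⬝ᵥ w + c * t := by
    intro a w t
    rw [hp, homVec_elim_dotProduct, zero_dotProduct, zero_add]
  set S := {z : RedIdx k r → ℝ | ∃ (a : Fin k → ℝ) (w : Fin r → ℝ) (t : ℝ),
    z = homVec (Sum.elim a w) t ∧ 0 ≤ t ∧ a ⬝ᵥ a ≤ t ^ 2 ∧ 0 ≤ p ⬝ᵥ z}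
  obtain ⟨η, h0, h1, h2⟩ := exists_multiplier (isSymm_toBilin' hA)
    (isSymm_toBilin' (J_isSymm k r)) S {z | p ⬝ᵥ z = 0}
    (by
      rintro _ ⟨a, w, t, rfl, ht, ha, -⟩
      rw [toBilin'_apply', J_form]
      linarith)
    (by
      rintro _ ⟨a, w, t, rfl, ht, ha, hpos⟩
      rw [toBilin'_apply']
      exact h a w t ht ha hpos)
    (by
      -- A direction in `p = 0` leaves the value of `p` unchanged, and the zeros of `J` on the line
      -- stay in the forward cone.
      rintro _ ⟨a, w, t, rfl, ht, ha, hpos⟩ hJz y hpy hJy θ hθ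
      obtain ⟨a', w', t', rfl⟩ := exists_eq_homVec_elim y
      have hpos' : 0 ≤ p ⬝ᵥ (homVec (Sum.elim a w) t + θ • homVec (Sum.elim a' w') t') := by
        rw [dotProduct_add, dotProduct_smul, hpy, smul_zero, add_zero]
        exact hpos
      rw [toBilin'_apply'] at hJz hJy hθ ⊢
      rw [smul_homVec, smul_sumElim, homVec_add, sumElim_add] at hθ hpos' ⊢
      rw [J_form] at hJz hJy hθ
      exact h _ _ _ (nonneg_of_on_boundary ht (sub_pos.1 hJz) (sub_neg.1 hJy) (sub_eq_zero.1 hθ).ge)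
        (by linarith) hpos')
    ⟨homVec (Sum.elim 0 (-(c / (b ⬝ᵥ b)) • b)) 1, ⟨_, _, _, rfl, zero_le_one, by simp, by
      rw [hpz, dotProduct_smul, smul_eq_mul, neg_mul, div_mul_cancel₀ _ hbb]
      simp⟩, by rw [toBilin'_apply', J_form]; simp⟩
  simp only [toBilin'_apply'] at h1 h2
  have hform : ∀ z : RedIdx k r → ℝ, z ⬝ᵥ (A - η • Data.J k r) *ᵥ z
      = z ⬝ᵥ A *ᵥ z - η * (z ⬝ᵥ Data.J k r *ᵥ z) := by
    intro z
    rw [sub_mulVec, smul_mulVec, dotProduct_sub, dotProduct_smul, smul_eq_mul]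
  obtain ⟨τ, u, hu, hfin⟩ := exists_lorentz_multiplier (A := A - η • Data.J k r) (p := p)
    (hA.sub ((J_isSymm k r).smul η)) (w₀ := (b ⬝ᵥ b)⁻¹ • b) rfl
    (by rw [hpz, dotProduct_smul, smul_eq_mul, inv_mul_cancel₀ hbb]; simp)
    (by
      intro z hz
      rw [hform, sub_nonneg]
      rcases lt_or_ge (z ⬝ᵥ Data.J k r *ᵥ z) 0 with hJz | hJz
      · exact h2 z hz hJz
      · obtain ⟨a, w, t, rfl⟩ := exists_eq_homVec_elim z
        have hat := hJz
        rw [J_form] at hat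
        rcases le_total 0 t with ht | ht
        · exact h1 _ ⟨a, w, t, rfl, ht, by linarith, hz.ge⟩
        · have e : homVec (Sum.elim (-a) (-w)) (-t) = -homVec (Sum.elim a w) t := by
            ext ((i | i) | i) <;> rfl
          have := h1 (-homVec (Sum.elim a w) t) ⟨-a, -w, -t, e.symm, by linarith,
            by simpa using hat, by rw [dotProduct_neg, hz, neg_zero]⟩
          rwa [mulVec_neg, mulVec_neg, neg_dotProduct_neg, neg_dotProduct_neg] at this)
    (by
      intro a w t ht ha hpos
      rw [hform, sub_nonneg]
      exact h1 _ ⟨a, w, t, rfl, ht, ha, hpos⟩)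
  refine ⟨η, τ, u, h0, hu, fun z => ?_⟩
  have := hfin z
  rw [hform] at this
  linarith

/-- If the `w`-block is positive definite, then a quadratic form becomes nonnegative after adding
a multiple of `‖a‖² + t²`. -/
theorem exists_nonneg_add_mul (A₁₂ : Matrix (Fin k) (Fin r) ℝ) {A₂₂ : Matrix (Fin r) (Fin r) ℝ}
    (h : A₂₂.PosDef) (b₁ : Fin k → ℝ) (b₂ : Fin r → ℝ) (c : ℝ) :
    ∃ K : ℝ, 0 ≤ K ∧ ∀ (a : Fin k → ℝ) (w : Fin r → ℝ) (t : ℝ),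
      0 ≤ homVec (Sum.elim a w) t ⬝ᵥ quadMatrix₂ 0 A₁₂ A₂₂ b₁ b₂ c *ᵥ homVec (Sum.elim a w) t
        + K * (a ⬝ᵥ a + t ^ 2) := by
  have bound : ∀ {m : ℕ} (B : Matrix (Fin m) (Fin m) ℝ), ∃ K : ℝ, 0 ≤ K ∧
      ∀ x, x ⬝ᵥ B *ᵥ x ≤ K * (x ⬝ᵥ x) := by
    intro m B
    refine ⟨∑ i, ∑ j, |B i j|, by positivity, fun x => ?_⟩
    simp only [dotProduct, mulVec]
    rw [Finset.sum_mul]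
    refine Finset.sum_le_sum fun i _ => ?_
    rw [Finset.sum_mul, Finset.mul_sum]
    refine Finset.sum_le_sum fun j _ => ?_
    have hi : x i * x i ≤ ∑ l, x l * x l :=
      Finset.single_le_sum (f := fun l => x l * x l) (fun l _ => mul_self_nonneg _)
        (Finset.mem_univ i)
    have hj : x j * x j ≤ ∑ l, x l * x l :=
      Finset.single_le_sum (f := fun l => x l * x l) (fun l _ => mul_self_nonneg _)
        (Finset.mem_univ j)
    have h1 : |x i * x j| ≤ ∑ l, x l * x l := by
      rw [abs_le]
      constructor <;> nlinarith [sq_nonneg (x i + x j), sq_nonneg (x i - x j)]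
    calc x i * (B i j * x j) = B i j * (x i * x j) := by ring
      _ ≤ |B i j * (x i * x j)| := le_abs_self _
      _ = |B i j| * |x i * x j| := abs_mul _ _
      _ ≤ _ := mul_le_mul_of_nonneg_left h1 (abs_nonneg _)
  obtain ⟨K₁, hK₁, h₁⟩ := bound A₂₂⁻¹
  obtain ⟨K₂, hK₂, h₂⟩ := bound (A₁₂ * A₁₂ᵀ)
  -- Completing the square in `w` costs `eᵀ A₂₂⁻¹ e ≤ K₁ ‖e‖²` with `e = A₁₂ᵀ a + t b₂`, which gives
  -- the first two terms. The terms `1 + b₁ ⬝ᵥ b₁` absorb `2 t (b₁ ⬝ᵥ a)`, and `|c|` absorbs `c t²`.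
  refine ⟨2 * K₁ * K₂ + 2 * K₁ * (b₂ ⬝ᵥ b₂) + 1 + b₁ ⬝ᵥ b₁ + |c|, ?_, fun a w t => ?_⟩
  · have := dotProduct_self_nonneg' b₁
    have := dotProduct_self_nonneg' b₂
    positivity
  rw [quadMatrix₂_form]
  obtain ⟨e, he⟩ : ∃ e : Fin r → ℝ, e = A₁₂ᵀ *ᵥ a + t • b₂ := ⟨_, rfl⟩
  have hS : A₂₂.IsSymm := by
    have := h.1
    rwa [IsHermitian, conjTranspose_eq_transpose_of_trivial] at this
  have hinv : A₂₂ *ᵥ (A₂₂⁻¹ *ᵥ e) = e := by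
    rw [mulVec_mulVec, mul_nonsing_inv _ ((isUnit_iff_isUnit_det _).1 h.isUnit), one_mulVec]
  have sq := h.posSemidef.dotProduct_mulVec_nonneg (w + A₂₂⁻¹ *ᵥ e)
  have hcross : (A₂₂⁻¹ *ᵥ e) ⬝ᵥ A₂₂ *ᵥ w = w ⬝ᵥ e := by
    rw [dotProduct_mulVec, ← mulVec_transpose, hS.eq, hinv, dotProduct_comm]
  rw [star_trivial, mulVec_add, hinv, add_dotProduct, dotProduct_add, dotProduct_add, hcross,
    dotProduct_comm (A₂₂⁻¹ *ᵥ e) e] at sq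
  have hwe : w ⬝ᵥ e = a ⬝ᵥ A₁₂ *ᵥ w + t * (b₂ ⬝ᵥ w) := by
    rw [he, dotProduct_add, dotProduct_smul, smul_eq_mul, dotProduct_comm w b₂, mulVec_transpose,
      dotProduct_comm w, ← dotProduct_mulVec]
  have hee : e ⬝ᵥ e ≤ 2 * (K₂ * (a ⬝ᵥ a)) + 2 * (t ^ 2 * (b₂ ⬝ᵥ b₂)) := by
    have h3 := dotProduct_self_nonneg' (A₁₂ᵀ *ᵥ a - t • b₂)
    have h4 := h₂ a
    rw [← mulVec_mulVec, dotProduct_mulVec, ← mulVec_transpose] at h4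
    simp only [he, add_dotProduct, dotProduct_add, sub_dotProduct, dotProduct_sub,
      smul_dotProduct, dotProduct_smul, smul_eq_mul] at h3 ⊢
    nlinarith
  have h5 := (h₁ e).trans (mul_le_mul_of_nonneg_left hee hK₁)
  have h6 := dotProduct_self_nonneg' (a + t • b₁)
  have hb₁ := dotProduct_self_nonneg' b₁
  have hb₂ := dotProduct_self_nonneg' b₂
  have ha := dotProduct_self_nonneg' a
  simp only [add_dotProduct, dotProduct_add, smul_dotProduct, dotProduct_smul, smul_eq_mul,
    dotProduct_comm a b₁] at h6
  have h7 := mul_le_mul_of_nonneg_right (neg_abs_le c) (sq_nonneg t)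
  simp only [zero_mulVec, dotProduct_zero]
  rw [hwe] at sq
  have n1 : 0 ≤ K₁ * K₂ * t ^ 2 := by positivity
  have n2 : 0 ≤ K₁ * (b₂ ⬝ᵥ b₂) * (a ⬝ᵥ a) := by positivity
  have n3 : 0 ≤ (b₁ ⬝ᵥ b₁) * (a ⬝ᵥ a) := by positivity
  have n4 : 0 ≤ |c| * (a ⬝ᵥ a) := by positivity
  nlinarith

end Copositive

namespace Data

variable {n k mf mg r : ℕ} (P : Data n k mf mg r)

/-! ### The linear matrix inequality -/

/-- The part of the linear matrix inequality that is free of multipliers. -/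
def core (d : Fin n → ℝ) (γ s : ℝ) : Matrix (RedIdx k r) (RedIdx k r) ℝ :=
  quadMatrix₂ 0 (-(1 / 2 : ℝ) • (P.Mᵀ * P.H)) (P.lam • (P.Hᵀ * P.Q * P.H))
    ((1 / 2 : ℝ) • P.Mᵀ *ᵥ d)
    (P.Hᵀ *ᵥ (P.lam • P.Q *ᵥ P.xp - (1 / 2 : ℝ) • P.μ₀))
    (γ - P.lam * s + P.μ₀ ⬝ᵥ d + P.lam * (P.xp ⬝ᵥ P.Q *ᵥ P.xp))

theorem reduced_isSymm (hQ : P.Q.IsSymm) : (P.lam • (P.Hᵀ * P.Q * P.H)).IsSymm := by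
  rw [IsSymm, transpose_smul, transpose_mul, transpose_mul, transpose_transpose, hQ.eq,
    Matrix.mul_assoc]

theorem core_isSymm (hQ : P.Q.IsSymm) (d : Fin n → ℝ) (γ s : ℝ) : (P.core d γ s).IsSymm :=
  quadMatrix₂_isSymm isSymm_zero _ (P.reduced_isSymm hQ) _ _ _

theorem lmi_isSymm (hQ : P.Q.IsSymm) (d : Fin n → ℝ) (γ s η : ℝ) (ξ : OffDiag mg → ℝ)
    (τ : Fin (mg + 1) → ℝ) (u : Fin (mg + 1) → Fin k → ℝ) :
    (P.lmi d γ s η ξ τ u).IsSymm := by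
  have h1 : (∑ e : OffDiag mg, ξ e • (vecMulVec (P.p e.1.1) (P.p e.1.2)
        + vecMulVec (P.p e.1.2) (P.p e.1.1))).IsSymm := by
    rw [IsSymm, transpose_sum]
    exact Finset.sum_congr rfl fun e _ => ((vecMulVec_add_swap_isSymm _ _).smul (ξ e)).eq
  have h2 : (∑ i, (vecMulVec (P.p i) (homVec (Sum.elim (u i) 0) (τ i))
        + vecMulVec (homVec (Sum.elim (u i) 0) (τ i)) (P.p i))).IsSymm := by
    rw [IsSymm, transpose_sum]
    exact Finset.sum_congr rfl fun i _ => (vecMulVec_add_swap_isSymm _ _).eq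
  exact (((P.core_isSymm hQ d γ s).sub ((J_isSymm k r).smul η)).sub h1).sub h2

theorem lmi_form (d : Fin n → ℝ) (γ s η : ℝ) (ξ : OffDiag mg → ℝ)
    (τ : Fin (mg + 1) → ℝ) (u : Fin (mg + 1) → Fin k → ℝ) (z : RedIdx k r → ℝ) :
    z ⬝ᵥ P.lmi d γ s η ξ τ u *ᵥ z = z ⬝ᵥ P.core d γ s *ᵥ z - η * (z ⬝ᵥ J k r *ᵥ z)
      - ∑ e : OffDiag mg, ξ e * (2 * ((P.p e.1.1 ⬝ᵥ z) * (P.p e.1.2 ⬝ᵥ z)))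
      - ∑ i, 2 * ((P.p i ⬝ᵥ z) * (homVec (Sum.elim (u i) 0) (τ i) ⬝ᵥ z)) := by
  change z ⬝ᵥ (P.core d γ s - η • J k r - _ - _) *ᵥ z = _
  simp only [sub_mulVec, dotProduct_sub, smul_mulVec, dotProduct_smul, smul_eq_mul, sum_mulVec,
    dotProduct_sum, vecMulVec_add_swap_form]

theorem posSemidef_lmi_iff (hQ : P.Q.IsSymm) {d : Fin n → ℝ} {γ s η : ℝ} {ξ : OffDiag mg → ℝ}
    {τ : Fin (mg + 1) → ℝ} {u : Fin (mg + 1) → Fin k → ℝ} :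
    (P.lmi d γ s η ξ τ u).PosSemidef ↔ ∀ z, 0 ≤ z ⬝ᵥ P.lmi d γ s η ξ τ u *ᵥ z := by
  refine ⟨fun h z => by simpa using h.dotProduct_mulVec_nonneg z, fun h => ?_⟩
  refine PosSemidef.of_dotProduct_mulVec_nonneg ?_ fun z => by simpa using h z
  rw [IsHermitian, conjTranspose_eq_transpose_of_trivial]
  exact P.lmi_isSymm hQ _ _ _ _ _ _ _

theorem p_zero_dotProduct (a : Fin k → ℝ) (w : Fin r → ℝ) (t : ℝ) :
    P.p 0 ⬝ᵥ homVec (Sum.elim a w) t = t := by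
  rw [p, Fin.cons_zero, homVec_elim_dotProduct]
  simp

theorem p_succ_dotProduct (i : Fin mg) (a : Fin k → ℝ) (w : Fin r → ℝ) (t : ℝ) :
    P.p i.succ ⬝ᵥ homVec (Sum.elim a w) t
      = (P.g i - (P.G *ᵥ P.xp) i) * t - (P.G *ᵥ (P.H *ᵥ w)) i := by
  have h : (-(P.G * P.H) i) ⬝ᵥ w = -(P.G *ᵥ (P.H *ᵥ w)) i := by
    rw [mulVec_mulVec, ← Pi.neg_apply, ← neg_mulVec]; rfl
  rw [p, Fin.cons_succ, homVec_elim_dotProduct, zero_dotProduct, h]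
  ring

/-! ### The regret constraint -/

theorem regretMatrix_isSymm (hQ : P.Q.IsSymm) (x : Fin n → ℝ) (γ : ℝ) :
    (P.regretMatrix x γ).IsSymm :=
  quadMatrix₂_isSymm isSymm_zero _ (hQ.smul _) _ _ _

theorem regretMatrix_form (x y : Fin n → ℝ) (γ : ℝ) (a : Fin k → ℝ) :
    homVec (Sum.elim a y) 1 ⬝ᵥ P.regretMatrix x γ *ᵥ homVec (Sum.elim a y) 1
      = γ - P.objective (P.μ₀ + P.M *ᵥ a) y + P.objective (P.μ₀ + P.M *ᵥ a) x := by
  have h : ∀ v, (P.M *ᵥ a) ⬝ᵥ v = a ⬝ᵥ P.Mᵀ *ᵥ v := fun v => by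
    rw [dotProduct_mulVec, vecMul_transpose]
  rw [regretMatrix, quadMatrix₂_form]
  simp only [objective, add_dotProduct, h, zero_mulVec, dotProduct_zero, smul_mulVec,
    dotProduct_smul, smul_dotProduct, smul_eq_mul, dotProduct_comm (P.Mᵀ *ᵥ x) a]
  ring

theorem regretMatrix_mem_copositivityCone_iff (hQ : P.Q.IsSymm) (x : Fin n → ℝ) (γ : ℝ) :
    P.regretMatrix x γ ∈ copositivityCone P.D ↔
      ∀ a : Fin k → ℝ, a ⬝ᵥ a ≤ 1 → ∀ y ∈ P.feasible,
        0 ≤ γ - P.objective (P.μ₀ + P.M *ᵥ a) y + P.objective (P.μ₀ + P.M *ᵥ a) x := by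
  constructor
  · rintro ⟨-, h⟩ a ha y ⟨hy₁, hy₂⟩
    rw [← regretMatrix_form]
    exact h _ ⟨a, y, rfl, ha, hy₁, hy₂⟩
  · refine fun h => ⟨P.regretMatrix_isSymm hQ x γ, ?_⟩
    rintro _ ⟨a, y, rfl, ha, hy₁, hy₂⟩
    rw [regretMatrix_form]
    exact h a ha y ⟨hy₁, hy₂⟩

/-- The value `objective μ x` is finite, so it moves across the inequality in `EReal` even when the
inner supremum is infinite or `P.feasible` is empty. -/
theorem maxRegret_le_iff (hQ : P.Q.IsSymm) (x : Fin n → ℝ) (γ : ℝ) :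
    P.maxRegret x ≤ (γ : EReal) ↔ P.regretMatrix x γ ∈ copositivityCone P.D := by
  rw [regretMatrix_mem_copositivityCone_iff P hQ]
  have key : ∀ μ, P.optValue μ - (P.objective μ x : EReal) ≤ (γ : EReal) ↔
      ∀ y ∈ P.feasible, 0 ≤ γ - P.objective μ y + P.objective μ x := by
    intro μ
    rw [EReal.sub_le_iff_le_add (Or.inl (EReal.coe_ne_bot _)) (Or.inl (EReal.coe_ne_top _)),
      ← EReal.coe_add, optValue, iSup₂_le_iff]
    refine forall₂_congr fun y _ => ?_
    rw [EReal.coe_le_coe_iff]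
    constructor <;> intro h <;> linarith
  rw [maxRegret, iSup₂_le_iff]
  constructor
  · exact fun h a ha => (key _).1 (h _ ⟨a, ha, rfl⟩)
  · rintro h _ ⟨a, ha, rfl⟩
    exact (key _).2 (h a ha)

/-- After `y = xp + H w` the multiplier-free block is the regret polynomial up to the error `lam *
(xᵀ Q x - s)`, which is nonpositive under the cone constraint and zero for `s = xᵀ Q x`. -/
theorem core_form (hQ : P.Q.IsSymm) (x : Fin n → ℝ) (γ s : ℝ) (a : Fin k → ℝ) (w : Fin r → ℝ) :
    homVec (Sum.elim a w) 1 ⬝ᵥ P.core (x - P.xp) γ s *ᵥ homVec (Sum.elim a w) 1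
      = γ - P.objective (P.μ₀ + P.M *ᵥ a) (P.xp + P.H *ᵥ w)
        + P.objective (P.μ₀ + P.M *ᵥ a) x + P.lam * (x ⬝ᵥ P.Q *ᵥ x - s) := by
  have h : ∀ v, (P.M *ᵥ a) ⬝ᵥ v = a ⬝ᵥ P.Mᵀ *ᵥ v := fun v => by
    rw [dotProduct_mulVec, vecMul_transpose]
  have hH : ∀ v, (P.Hᵀ *ᵥ v) ⬝ᵥ w = v ⬝ᵥ P.H *ᵥ w := fun v => by
    rw [mulVec_transpose, ← dotProduct_mulVec]
  have hcross : (P.H *ᵥ w) ⬝ᵥ P.Q *ᵥ P.xp = (P.Q *ᵥ P.xp) ⬝ᵥ P.H *ᵥ w := dotProduct_comm _ _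
  have hcross' : P.xp ⬝ᵥ P.Q *ᵥ (P.H *ᵥ w) = (P.Q *ᵥ P.xp) ⬝ᵥ P.H *ᵥ w := by
    rw [dotProduct_mulVec, ← mulVec_transpose, hQ.eq]
  have hH' : ∀ v, w ⬝ᵥ P.Hᵀ *ᵥ v = (P.H *ᵥ w) ⬝ᵥ v := fun v => by
    rw [dotProduct_comm, hH, dotProduct_comm]
  rw [core, quadMatrix₂_form]
  simp only [objective, add_dotProduct, dotProduct_add, mulVec_add, mulVec_sub, dotProduct_sub,
    sub_dotProduct, smul_sub, h, hH, hH', hcross, hcross', zero_mulVec, dotProduct_zero,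
    smul_mulVec, ← mulVec_mulVec,
    dotProduct_smul, smul_dotProduct, smul_eq_mul, dotProduct_comm (P.Mᵀ *ᵥ _) a]
  ring

/-! ### The second-order cone constraint -/

theorem socMatrix_mulVec {ι κ : Type*} [Fintype κ] (V : Matrix ι κ ℝ) (α s : ℝ) (w : κ → ℝ) :
    socMatrix V *ᵥ consVec α (consVec s w)
      = consVec (1 / √2 * (α + s)) (consVec (1 / √2 * (α - s)) (V *ᵥ w)) := by
  ext (i | i | i) <;>
    simp [socMatrix, consVec, mulVec, dotProduct] <;> ring

theorem consVec_dotProduct {ι : Type*} [Fintype ι] (α β : ℝ) (v w : ι → ℝ) :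
    consVec α v ⬝ᵥ consVec β w = α * β + v ⬝ᵥ w := by
  simp [consVec, dotProduct]

theorem consVec_add {ι : Type*} (α β : ℝ) (v w : ι → ℝ) :
    consVec α v + consVec β w = consVec (α + β) (v + w) := by
  ext (i | i) <;> rfl

theorem smul_consVec {ι : Type*} (c α : ℝ) (v : ι → ℝ) :
    c • consVec α v = consVec (c * α) (c • v) := by
  ext (i | i) <;> rfl

theorem form_eq_of_factor (hU : P.Q = P.Uᵀ * P.U) (x : Fin n → ℝ) :
    x ⬝ᵥ P.Q *ᵥ x = (P.U *ᵥ x) ⬝ᵥ (P.U *ᵥ x) := by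
  rw [hU, ← mulVec_mulVec, dotProduct_mulVec, vecMul_transpose]

/-- Half of `(1/2 + s)² - (1/2 - s)²` equals `s`, so the squared cone inequality reads `‖U x‖² ≤ s`;
the sign condition on the first entry then comes for free. -/
theorem socVec_mem_iff (hU : P.Q = P.Uᵀ * P.U) (x : Fin n → ℝ) (s : ℝ) :
    P.socVec x s ∈ lorentzCone (Unit ⊕ Fin n) ↔ x ⬝ᵥ P.Q *ᵥ x ≤ s := by
  rw [socVec, socMatrix_mulVec, mem_lorentzCone_consVec, consVec_dotProduct,
    P.form_eq_of_factor hU]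
  have h0 := dotProduct_self_nonneg' (P.U *ᵥ x)
  have h2 : (1 / √2) ^ 2 = (1 / 2 : ℝ) := by
    rw [div_pow, one_pow, Real.sq_sqrt zero_le_two]
  have hpos : 0 < 1 / √2 := by positivity
  have e1 : 1 / √2 * (1 / 2 - s) * (1 / √2 * (1 / 2 - s)) = 1 / 2 * (1 / 2 - s) ^ 2 := by
    rw [← h2]; ring
  rw [mul_nonneg_iff_of_pos_left hpos, mul_pow, h2, e1]
  constructor
  · rintro ⟨-, h⟩
    linarith
  · intro h
    constructor <;> linarith

end Data

/-- The two dual descriptions of the quadratic functions that are nonnegative on `D`. -/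
theorem mem_copositivityCone_iff_mem_dualHullCone {ι : Type*} [Fintype ι] {D : Set (ι → ℝ)}
    {A : Matrix (ι ⊕ Unit) (ι ⊕ Unit) ℝ} : A ∈ copositivityCone D ↔ A ∈ dualHullCone D := by
  have htr : ∀ z : ι ⊕ Unit → ℝ, ((vecMulVec z z)ᵀ * A).trace = z ⬝ᵥ A *ᵥ z := fun z => by
    rw [transpose_vecMulVec, vecMulVec_mul, trace_vecMulVec, dotProduct_mulVec, dotProduct_comm]
  refine and_congr_right fun _ => ⟨fun h => ?_, fun h x hx => ?_⟩
  -- Scaling handles `t > 0`; the closure adds nothing because the form is continuous.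
  · have hclosed : homogenization D ⊆ {z | 0 ≤ z ⬝ᵥ A *ᵥ z} := by
      refine closure_minimal ?_ (isClosed_le continuous_const (by fun_prop))
      rintro _ ⟨x, t, rfl, ht, hx⟩
      have e : homVec x t = t • homVec (t⁻¹ • x) 1 := by
        rw [smul_homVec, smul_inv_smul₀ ht.ne', mul_one]
      rw [Set.mem_ofPred_eq, e, mulVec_smul, smul_dotProduct, dotProduct_smul, smul_eq_mul,
        smul_eq_mul]
      exact mul_nonneg ht.le (mul_nonneg ht.le (h _ hx))
    have hconv : Convex ℝ {X : Matrix (ι ⊕ Unit) (ι ⊕ Unit) ℝ | 0 ≤ (Xᵀ * A).trace} := by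
      intro X hX Y hY α β hα hβ _
      simp only [Set.mem_ofPred_eq, transpose_add, transpose_smul, Matrix.add_mul,
        Matrix.smul_mul, trace_add, trace_smul, smul_eq_mul] at hX hY ⊢
      positivity
    refine fun X hX => convexHull_min ?_ hconv hX
    rintro _ ⟨z, hz, rfl⟩
    rw [Set.mem_ofPred_eq, htr]
    exact hclosed hz
  · rw [← htr]
    exact h _ (subset_convexHull ℝ _
      ⟨_, subset_closure ⟨x, 1, rfl, one_pos, by rwa [inv_one, one_smul]⟩, rfl⟩)

namespace Data

variable {n k mf mg r : ℕ} (P : Data n k mf mg r)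

/-! ### Sufficiency of the explicit system -/

theorem mulVec_param (hxp : P.F *ᵥ P.xp = P.f)
    (hHker : Submodule.span ℝ (Set.range P.H.col) = LinearMap.ker P.F.mulVecLin)
    (w : Fin r → ℝ) : P.F *ᵥ (P.xp + P.H *ᵥ w) = P.f := by
  have h : P.H *ᵥ w ∈ LinearMap.ker P.F.mulVecLin := by
    rw [← hHker, ← range_mulVecLin]
    exact ⟨w, rfl⟩
  have h' : P.F *ᵥ (P.H *ᵥ w) = 0 := h
  rw [mulVec_add, hxp, h', add_zero]

theorem exists_param (hxp : P.F *ᵥ P.xp = P.f)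
    (hHker : Submodule.span ℝ (Set.range P.H.col) = LinearMap.ker P.F.mulVecLin)
    {y : Fin n → ℝ} (hy : P.F *ᵥ y = P.f) : ∃ w, P.xp + P.H *ᵥ w = y := by
  have h : y - P.xp ∈ LinearMap.ker P.F.mulVecLin := by
    rw [LinearMap.mem_ker, mulVecLin_apply, mulVec_sub, hy, hxp, sub_self]
  rw [← hHker, ← range_mulVecLin] at h
  obtain ⟨w, hw⟩ := h
  exact ⟨w, by rw [← mulVecLin_apply, hw, add_sub_cancel]⟩

/-- At `(a, w, 1)` with `xp + H w` feasible and `‖a‖ ≤ 1`, every subtracted multiplier term is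
nonnegative, so the core is nonnegative too. -/
theorem copositive_of_system (hlam : 0 ≤ P.lam) (hU : P.Q = P.Uᵀ * P.U) (hQ : P.Q.IsSymm)
    (hxp : P.F *ᵥ P.xp = P.f)
    (hHker : Submodule.span ℝ (Set.range P.H.col) = LinearMap.ker P.F.mulVecLin)
    {x : Fin n → ℝ} {γ : ℝ} (h : P.System x γ) :
    P.regretMatrix x γ ∈ copositivityCone P.D := by
  obtain ⟨s, η, ξ, τ, u, hη, hξ, hu, hs, hpsd⟩ := h
  rw [P.socVec_mem_iff hU] at hs
  rw [P.regretMatrix_mem_copositivityCone_iff hQ]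
  rintro a ha y ⟨hy₁, hy₂⟩
  obtain ⟨w, rfl⟩ := P.exists_param hxp hHker hy₁
  have h0 := (P.posSemidef_lmi_iff hQ).1 hpsd (homVec (Sum.elim a w) 1)
  rw [lmi_form, P.core_form hQ, J_form] at h0
  have hp : ∀ i, 0 ≤ P.p i ⬝ᵥ homVec (Sum.elim a w) 1 := by
    refine Fin.cases ?_ fun i => ?_
    · rw [p_zero_dotProduct]
      exact zero_le_one
    · have := hy₂ i
      rw [mulVec_add, Pi.add_apply] at this
      rw [p_succ_dotProduct]
      linarith
  have h1 : 0 ≤ ∑ e : OffDiag mg, ξ e * (2 * ((P.p e.1.1 ⬝ᵥ homVec (Sum.elim a w) 1) *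
      (P.p e.1.2 ⬝ᵥ homVec (Sum.elim a w) 1))) :=
    Finset.sum_nonneg fun e _ => mul_nonneg (hξ e)
      (mul_nonneg zero_le_two (mul_nonneg (hp _) (hp _)))
  have h2 : 0 ≤ ∑ i, 2 * ((P.p i ⬝ᵥ homVec (Sum.elim a w) 1) *
      (homVec (Sum.elim (u i) 0) (τ i) ⬝ᵥ homVec (Sum.elim a w) 1)) := by
    refine Finset.sum_nonneg fun i _ => mul_nonneg zero_le_two (mul_nonneg (hp i) ?_)
    obtain ⟨hτ, hui⟩ := mem_lorentzCone_consVec.1 (hu i)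
    rw [homVec_elim_dotProduct, zero_dotProduct, add_zero]
    exact dotProduct_add_mul_nonneg hτ hui zero_le_one (by simpa using ha)
  have h3 : 0 ≤ η * (1 ^ 2 - a ⬝ᵥ a) := mul_nonneg hη (by linarith)
  have h4 : P.lam * (x ⬝ᵥ P.Q *ᵥ x - s) ≤ 0 :=
    mul_nonpos_of_nonneg_of_nonpos hlam (by linarith)
  linarith

/-! ### Necessity of the explicit system -/

theorem core_nonneg_of_copositive (hlam : 0 ≤ P.lam) (hU : P.Q = P.Uᵀ * P.U) (hQ : P.Q.IsSymm)
    (hxp : P.F *ᵥ P.xp = P.f)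
    (hHker : Submodule.span ℝ (Set.range P.H.col) = LinearMap.ker P.F.mulVecLin)
    {x : Fin n → ℝ} {γ : ℝ} (h : P.regretMatrix x γ ∈ copositivityCone P.D)
    {a : Fin k → ℝ} {w : Fin r → ℝ} {t : ℝ} (ht : 0 ≤ t) (ha : a ⬝ᵥ a ≤ t ^ 2)
    (hp : ∀ i : Fin mg, 0 ≤ P.p i.succ ⬝ᵥ homVec (Sum.elim a w) t) :
    0 ≤ homVec (Sum.elim a w) t ⬝ᵥ P.core (x - P.xp) γ (x ⬝ᵥ P.Q *ᵥ x)
      *ᵥ homVec (Sum.elim a w) t := by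
  -- At `t = 0` also `a = 0`, and only `lam * ‖U H w‖²` survives; this needs no feasible point. For
  -- `t > 0`, rescale to `t = 1`.
  rcases ht.eq_or_lt with rfl | ht
  · obtain rfl : a = 0 := dotProduct_self_eq_zero.1
      (le_antisymm (by simpa using ha) (dotProduct_self_nonneg' a))
    have e : w ⬝ᵥ (P.Hᵀ * P.Q * P.H) *ᵥ w = (P.H *ᵥ w) ⬝ᵥ P.Q *ᵥ (P.H *ᵥ w) := by
      rw [← mulVec_mulVec, ← mulVec_mulVec, dotProduct_mulVec, vecMul_transpose]
    rw [core, quadMatrix₂_form, smul_mulVec P.lam, dotProduct_smul P.lam, e,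
      P.form_eq_of_factor hU (P.H *ᵥ w)]
    have := mul_nonneg hlam (dotProduct_self_nonneg' (P.U *ᵥ (P.H *ᵥ w)))
    simpa using this
  · rw [P.regretMatrix_mem_copositivityCone_iff hQ] at h
    have e : homVec (Sum.elim a w) t = t • homVec (Sum.elim (t⁻¹ • a) (t⁻¹ • w)) 1 := by
      rw [smul_homVec, smul_sumElim, smul_inv_smul₀ ht.ne', smul_inv_smul₀ ht.ne', mul_one]
    rw [e, mulVec_smul, smul_dotProduct, dotProduct_smul, smul_eq_mul, smul_eq_mul,
      P.core_form hQ, sub_self, mul_zero, add_zero]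
    refine mul_nonneg ht.le (mul_nonneg ht.le (h _ ?_ _ ⟨P.mulVec_param hxp hHker _, fun i => ?_⟩))
    · rw [smul_dotProduct, dotProduct_smul, smul_eq_mul, smul_eq_mul, ← mul_assoc, ← mul_inv,
        inv_mul_le_iff₀ (by positivity)]
      linarith
    · have := hp i
      rw [p_succ_dotProduct] at this
      rw [mulVec_add, mulVec_smul, mulVec_smul, Pi.add_apply, Pi.smul_apply, smul_eq_mul]
      have h3 : t⁻¹ * (P.G *ᵥ (P.H *ᵥ w)) i ≤ P.g i - (P.G *ᵥ P.xp) i := by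
        rw [inv_mul_le_iff₀ ht]
        linarith
      linarith

/-- Multipliers for the ellipsoid and for one of the linear inequalities solve the system. -/
theorem system_of_multipliers (hU : P.Q = P.Uᵀ * P.U) (hQ : P.Q.IsSymm) {x : Fin n → ℝ}
    {γ η τ : ℝ} {u : Fin k → ℝ} (i : Fin (mg + 1)) (hη : 0 ≤ η)
    (hu : consVec τ u ∈ lorentzCone (Fin k))
    (h : ∀ z, η * (z ⬝ᵥ J k r *ᵥ z) + 2 * ((P.p i ⬝ᵥ z) * (homVec (Sum.elim u 0) τ ⬝ᵥ z))
      ≤ z ⬝ᵥ P.core (x - P.xp) γ (x ⬝ᵥ P.Q *ᵥ x) *ᵥ z) : P.System x γ := by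
  refine ⟨x ⬝ᵥ P.Q *ᵥ x, η, 0, Pi.single i τ, Pi.single i u, hη, fun e => le_rfl, fun j => ?_,
    (P.socVec_mem_iff hU x _).2 le_rfl, (P.posSemidef_lmi_iff hQ).2 fun z => ?_⟩
  · by_cases hj : j = i
    · subst hj
      rwa [Pi.single_eq_same, Pi.single_eq_same]
    · rw [Pi.single_eq_of_ne hj, Pi.single_eq_of_ne hj]
      exact mem_lorentzCone_consVec.2 ⟨le_rfl, by simp⟩
  · rw [lmi_form, Finset.sum_eq_single_of_mem i (Finset.mem_univ i), Pi.single_eq_same,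
      Pi.single_eq_same]
    · simp only [Pi.zero_apply, zero_mul, Finset.sum_const_zero, sub_zero]
      linarith [h z]
    · intro j _ hj
      have e : homVec (Sum.elim (0 : Fin k → ℝ) (0 : Fin r → ℝ)) 0 = 0 := by
        ext ((i | i) | i) <;> rfl
      rw [Pi.single_eq_of_ne hj, Pi.single_eq_of_ne hj, e, zero_dotProduct, mul_zero, mul_zero]

theorem system_of_core_nonneg (hU : P.Q = P.Uᵀ * P.U) (hQ : P.Q.IsSymm) {x : Fin n → ℝ} {γ : ℝ}
    (h : ∀ (a : Fin k → ℝ) (w : Fin r → ℝ) (t : ℝ), 0 ≤ t → a ⬝ᵥ a ≤ t ^ 2 →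
      0 ≤ homVec (Sum.elim a w) t ⬝ᵥ P.core (x - P.xp) γ (x ⬝ᵥ P.Q *ᵥ x)
        *ᵥ homVec (Sum.elim a w) t) : P.System x γ := by
  obtain ⟨η, hη, h1⟩ := exists_multiplier_J (P.core_isSymm hQ _ _ _) h
  refine P.system_of_multipliers hU hQ (τ := 0) (u := 0) 0 hη
    (mem_lorentzCone_consVec.2 ⟨le_rfl, by simp⟩) fun z => ?_
  have e : homVec (Sum.elim (0 : Fin k → ℝ) (0 : Fin r → ℝ)) 0 = 0 := by
    ext ((i | i) | i) <;> rfl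
  rw [e, zero_dotProduct, mul_zero, mul_zero, add_zero]
  exact h1 z

theorem reduced_posDef (hlam : 0 < P.lam) (hQ : P.Q.PosDef) (hH : LinearIndependent ℝ P.H.col) :
    (P.lam • (P.Hᵀ * P.Q * P.H)).PosDef := by
  have := hQ.conjTranspose_mul_mul_same (mulVec_injective_iff.2 hH)
  rw [conjTranspose_eq_transpose_of_trivial] at this
  exact this.smul hlam

theorem system_of_copositive (hlam : 0 ≤ P.lam) (hU : P.Q = P.Uᵀ * P.U) (hQ : P.Q.IsSymm)
    (hxp : P.F *ᵥ P.xp = P.f) (hH : LinearIndependent ℝ P.H.col)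
    (hHker : Submodule.span ℝ (Set.range P.H.col) = LinearMap.ker P.F.mulVecLin)
    (hmg : mg = 0 ∨ mg = 1) (hreg : P.feasible.Nonempty ∨ (0 < P.lam ∧ P.Q.PosDef))
    {x : Fin n → ℝ} {γ : ℝ} (h : P.regretMatrix x γ ∈ copositivityCone P.D) : P.System x γ := by
  have hcore := fun a w t ht ha =>
    P.core_nonneg_of_copositive (a := a) (w := w) (t := t) hlam hU hQ hxp hHker h ht ha
  rcases hmg with rfl | rfl
  · exact P.system_of_core_nonneg hU hQ fun a w t ht ha => hcore a w t ht ha fun i => i.elim0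
  have hp : P.p (Fin.succ 0) = homVec (Sum.elim 0 (-(P.G * P.H) 0)) (P.g 0 - (P.G *ᵥ P.xp) 0) :=
    rfl
  by_cases hb : (-(P.G * P.H) 0 : Fin r → ℝ) = 0
  · have hGH : ∀ w, (P.G *ᵥ (P.H *ᵥ w)) 0 = 0 := fun w => by
      rw [mulVec_mulVec]
      change (P.G * P.H) 0 ⬝ᵥ w = 0
      have hb' : (P.G * P.H) 0 = 0 := neg_eq_zero.1 hb
      rw [hb', zero_dotProduct]
    rcases le_or_gt 0 (P.g 0 - (P.G *ᵥ P.xp) 0) with hc | hc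
    · refine P.system_of_core_nonneg hU hQ fun a w t ht ha => hcore a w t ht ha fun i => ?_
      rw [Subsingleton.elim i 0, p_succ_dotProduct, hGH, sub_zero]
      exact mul_nonneg hc ht
    · have hempty : ¬ P.feasible.Nonempty := by
        rintro ⟨y, hy₁, hy₂⟩
        obtain ⟨w, rfl⟩ := P.exists_param hxp hHker hy₁
        have := hy₂ 0
        rw [mulVec_add, Pi.add_apply, hGH] at this
        linarith
      obtain ⟨hlam', hQ'⟩ := hreg.resolve_left hempty
      obtain ⟨K, hK, hK'⟩ := exists_nonneg_add_mul (-(1 / 2 : ℝ) • (P.Mᵀ * P.H))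
        (P.reduced_posDef hlam' hQ' hH) ((1 / 2 : ℝ) • P.Mᵀ *ᵥ (x - P.xp))
        (P.Hᵀ *ᵥ (P.lam • P.Q *ᵥ P.xp - (1 / 2 : ℝ) • P.μ₀))
        (γ - P.lam * (x ⬝ᵥ P.Q *ᵥ x) + P.μ₀ ⬝ᵥ (x - P.xp)
          + P.lam * (P.xp ⬝ᵥ P.Q *ᵥ P.xp))
      -- Here `p = c t` with `c < 0`. The choice `η = K`, `τ = K / (-c)` makes the multiplier terms
      -- `K (t² - ‖a‖²) - 2 K t² = -K (‖a‖² + t²)`.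
      refine P.system_of_multipliers hU hQ (τ := K / -(P.g 0 - (P.G *ᵥ P.xp) 0)) (u := 0)
        (Fin.succ 0) hK (mem_lorentzCone_consVec.2
          ⟨div_nonneg hK (by linarith), by rw [zero_dotProduct]; positivity⟩) fun z => ?_
      obtain ⟨a, w, t, rfl⟩ := exists_eq_homVec_elim z
      have h1 := hK' a w t
      rw [J_form, p_succ_dotProduct, hGH, homVec_elim_dotProduct, zero_dotProduct,
        zero_dotProduct, sub_zero, zero_add, zero_add]
      have e : (P.g 0 - (P.G *ᵥ P.xp) 0) * t * (K / -(P.g 0 - (P.G *ᵥ P.xp) 0) * t)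
          = -(K * t ^ 2) := by
        rw [div_neg, neg_mul, mul_neg, mul_mul_mul_comm, mul_div_cancel₀ _ hc.ne, sq]
      rw [e, core]
      linarith
  · obtain ⟨η, τ, u, hη, hu, h1⟩ := exists_multipliers_of_halfspace
      (P.core_isSymm hQ (x - P.xp) γ (x ⬝ᵥ P.Q *ᵥ x)) hp hb fun a w t ht ha hpos =>
        hcore a w t ht ha fun i => by rwa [Subsingleton.elim i 0]
    exact P.system_of_multipliers hU hQ _ hη hu h1

/-! ### The conic problem -/

theorem mem_arrpFeasible_iff (hxp : P.F *ᵥ P.xp = P.f)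
    (hHker : Submodule.span ℝ (Set.range P.H.col) = LinearMap.ker P.F.mulVecLin)
    (w : Fin r → ℝ) (γ s η : ℝ) (ξ : OffDiag mg → ℝ) (τ : Fin (mg + 1) → ℝ)
    (u : Fin (mg + 1) → Fin k → ℝ) :
    (w, γ, s, η, ξ, τ, u) ∈ P.arrpFeasible ↔
      P.xp + P.H *ᵥ w ∈ P.feasible ∧ 0 ≤ η ∧ (∀ e, 0 ≤ ξ e) ∧
        (∀ i, consVec (τ i) (u i) ∈ lorentzCone (Fin k)) ∧
        P.socVec (P.xp + P.H *ᵥ w) s ∈ lorentzCone (Unit ⊕ Fin n) ∧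
        (P.lmi (P.xp + P.H *ᵥ w - P.xp) γ s η ξ τ u).PosSemidef := by
  have hsoc : P.socVec (P.xp + P.H *ᵥ w) s = consVec 0 (consVec 0 (P.U *ᵥ P.xp))
      + socMatrix (P.U * P.H) *ᵥ consVec (1 / 2) (consVec s w) := by
    rw [socVec, socMatrix_mulVec, socMatrix_mulVec, consVec_add, consVec_add, zero_add, zero_add,
      mulVec_add, mulVec_mulVec]
  have hfeas : P.xp + P.H *ᵥ w ∈ P.feasible ↔
      0 ≤ P.g - P.G *ᵥ P.xp - (P.G * P.H) *ᵥ w := by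
    rw [sub_sub, sub_nonneg, ← mulVec_mulVec, ← mulVec_add]
    exact and_iff_right (P.mulVec_param hxp hHker w)
  rw [hfeas, hsoc, add_sub_cancel_left]
  simp only [arrpFeasible, arrpCone, arrpMap, Set.mem_ofPred_eq, Set.mem_inter_iff, and_assoc,
    Pi.le_def, Pi.zero_apply]

/-- The map `w ↦ xp + H w` is onto the solutions of `F x = f`, so the equality constraint disappears
and only the inequalities and the system remain. -/
theorem exists_mem_arrpFeasible_iff (hxp : P.F *ᵥ P.xp = P.f)
    (hHker : Submodule.span ℝ (Set.range P.H.col) = LinearMap.ker P.F.mulVecLin)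
    (x : Fin n → ℝ) (γ : ℝ) :
    (∃ v ∈ P.arrpFeasible, P.xp + P.H *ᵥ v.1 = x ∧ v.2.1 = γ) ↔
      x ∈ P.feasible ∧ P.System x γ := by
  constructor
  · rintro ⟨⟨w, γ, s, η, ξ, τ, u⟩, hv, rfl, rfl⟩
    rw [P.mem_arrpFeasible_iff hxp hHker] at hv
    exact ⟨hv.1, s, η, ξ, τ, u, hv.2⟩
  · rintro ⟨hx, s, η, ξ, τ, u, h⟩
    obtain ⟨w, rfl⟩ := P.exists_param hxp hHker hx.1
    exact ⟨(w, γ, s, η, ξ, τ, u), (P.mem_arrpFeasible_iff hxp hHker _ _ _ _ _ _ _).2 ⟨hx, h⟩,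
      rfl, rfl⟩

/-- The linear part of the constraint expressions. -/
def arrpLinear : Var k mg r →ₗ[ℝ] ConSpace n k mg r where
  toFun := fun (w, γ, s, η, ξ, τ, u) =>
    (-((P.G * P.H) *ᵥ w), η, ξ, fun i => consVec (τ i) (u i),
      socMatrix (P.U * P.H) *ᵥ consVec 0 (consVec s w),
      quadMatrix₂ 0 0 0 ((1 / 2 : ℝ) • P.Mᵀ *ᵥ (P.H *ᵥ w)) 0
          (γ - P.lam * s + P.μ₀ ⬝ᵥ (P.H *ᵥ w))
        - η • J k r
        - ∑ e : OffDiag mg, ξ e • (vecMulVec (P.p e.1.1) (P.p e.1.2)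
            + vecMulVec (P.p e.1.2) (P.p e.1.1))
        - ∑ i, (vecMulVec (P.p i) (homVec (Sum.elim (u i) 0) (τ i))
            + vecMulVec (homVec (Sum.elim (u i) 0) (τ i)) (P.p i)))
  map_add' := by
    rintro ⟨w, γ, s, η, ξ, τ, u⟩ ⟨w', γ', s', η', ξ', τ', u'⟩
    have hv : ∀ i, homVec (Sum.elim (u i + u' i) (0 : Fin r → ℝ)) (τ i + τ' i)
        = homVec (Sum.elim (u i) 0) (τ i) + homVec (Sum.elim (u' i) 0) (τ' i) := fun i => by
      rw [homVec_add, sumElim_add, add_zero]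
    have hq : quadMatrix₂ (0 : Matrix (Fin k) (Fin k) ℝ) 0 (0 : Matrix (Fin r) (Fin r) ℝ)
        ((1 / 2 : ℝ) • P.Mᵀ *ᵥ (P.H *ᵥ (w + w'))) 0
          (γ + γ' - P.lam * (s + s') + P.μ₀ ⬝ᵥ (P.H *ᵥ (w + w')))
        = quadMatrix₂ 0 0 0 ((1 / 2 : ℝ) • P.Mᵀ *ᵥ (P.H *ᵥ w)) 0
          (γ - P.lam * s + P.μ₀ ⬝ᵥ (P.H *ᵥ w))
        + quadMatrix₂ 0 0 0 ((1 / 2 : ℝ) • P.Mᵀ *ᵥ (P.H *ᵥ w')) 0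
          (γ' - P.lam * s' + P.μ₀ ⬝ᵥ (P.H *ᵥ w')) := by
      rw [quadMatrix₂_add, mulVec_add, mulVec_add, smul_add, dotProduct_add]
      congr 1
      · simp
      · simp
      · simp
      · simp
      · ring
    simp only [Prod.mk_add_mk, Pi.add_apply, mulVec_add, neg_add, Prod.mk.injEq,
      true_and]
    refine ⟨?_, ?_, ?_⟩
    · funext i
      exact (consVec_add _ _ _ _).symm
    · rw [← mulVec_add, consVec_add, consVec_add, add_zero]
    · rw [← mulVec_add, ← mulVec_add, hq]
      simp only [hv, vecMulVec_add, add_vecMulVec, add_smul, Finset.sum_add_distrib, smul_add]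
      abel
  map_smul' := by
    rintro c ⟨w, γ, s, η, ξ, τ, u⟩
    have hv : ∀ i, homVec (Sum.elim (c • u i) (0 : Fin r → ℝ)) (c * τ i)
        = c • homVec (Sum.elim (u i) 0) (τ i) := fun i => by
      rw [smul_homVec, smul_sumElim, smul_zero]
    have hq : quadMatrix₂ (0 : Matrix (Fin k) (Fin k) ℝ) 0 (0 : Matrix (Fin r) (Fin r) ℝ)
        ((1 / 2 : ℝ) • P.Mᵀ *ᵥ (P.H *ᵥ (c • w))) 0
          (c * γ - P.lam * (c * s) + P.μ₀ ⬝ᵥ (P.H *ᵥ (c • w)))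
        = c • quadMatrix₂ 0 0 0 ((1 / 2 : ℝ) • P.Mᵀ *ᵥ (P.H *ᵥ w)) 0
          (γ - P.lam * s + P.μ₀ ⬝ᵥ (P.H *ᵥ w)) := by
      rw [smul_quadMatrix₂, mulVec_smul, mulVec_smul, dotProduct_smul, smul_comm c]
      congr 1
      · simp
      · simp
      · simp
      · simp
      · simp only [smul_eq_mul]
        ring
    simp only [RingHom.id_apply, Prod.smul_mk, Pi.smul_apply, smul_eq_mul, Prod.mk.injEq,
      true_and]
    refine ⟨?_, ?_, ?_, ?_⟩
    · rw [mulVec_smul, smul_neg]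
    · funext i
      exact (smul_consVec _ _ _).symm
    · rw [← mulVec_smul, smul_consVec, smul_consVec, mul_zero]
    · rw [hq]
      simp only [hv, vecMulVec_smul, smul_vecMulVec, smul_sub, Finset.smul_sum, smul_add,
        mul_smul]

theorem exists_affineMap_eq_arrpMap :
    ∃ A : Var k mg r →ᵃ[ℝ] ConSpace n k mg r, ∀ v, A v = P.arrpMap v := by
  refine ⟨⟨P.arrpMap, P.arrpLinear, ?_⟩, fun v => rfl⟩
  rintro ⟨w, γ, s, η, ξ, τ, u⟩ ⟨w', γ', s', η', ξ', τ', u'⟩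
  have hsum : ((w', γ', s', η', ξ', τ', u') : Var k mg r) +ᵥ (w, γ, s, η, ξ, τ, u)
      = (w' + w, γ' + γ, s' + s, η' + η, ξ' + ξ, τ' + τ, u' + u) := rfl
  have hv : ∀ i, homVec (Sum.elim (u' i + u i) (0 : Fin r → ℝ)) (τ' i + τ i)
      = homVec (Sum.elim (u' i) 0) (τ' i) + homVec (Sum.elim (u i) 0) (τ i) := fun i => by
    rw [homVec_add, sumElim_add, add_zero]
  have hq : P.core (P.H *ᵥ (w' + w)) (γ' + γ) (s' + s)
      = quadMatrix₂ 0 0 0 ((1 / 2 : ℝ) • P.Mᵀ *ᵥ (P.H *ᵥ w')) 0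
          (γ' - P.lam * s' + P.μ₀ ⬝ᵥ (P.H *ᵥ w')) + P.core (P.H *ᵥ w) γ s := by
    rw [core, core, quadMatrix₂_add, mulVec_add, mulVec_add, smul_add, dotProduct_add, zero_add,
      zero_add, zero_add, zero_add]
    congr 1
    ring
  rw [hsum, vadd_eq_add]
  simp only [arrpMap, arrpLinear, LinearMap.coe_mk, AddHom.coe_mk, Prod.mk_add_mk, Prod.mk.injEq,
    true_and]
  refine ⟨?_, ?_, ?_, ?_⟩
  · rw [mulVec_add]
    abel
  · funext i
    exact (consVec_add _ _ _ _).symm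
  · rw [add_left_comm, ← mulVec_add, consVec_add, consVec_add, zero_add]
  · change P.core _ _ _ - _ - _ - _ = _ + (P.core _ _ _ - _ - _ - _)
    rw [hq]
    simp only [Pi.add_apply, hv, vecMulVec_add, add_vecMulVec, add_smul, Finset.sum_add_distrib,
      smul_add]
    abel

end Data

end RelRobust

end

/-! ### Assembly of the claims -/

theorem corollary5p8 {n k mf mg r : ℕ} (P : RelRobust.Data n k mf mg r)
    (hlam : 0 ≤ P.lam)
    (hU : P.Q = P.U.transpose * P.U)
    (hF : LinearIndependent ℝ P.F.row)
    (hr : r = n - mf)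
    (hxp : P.F.mulVec P.xp = P.f)
    (hH : LinearIndependent ℝ P.H.col)
    (hHker : Submodule.span ℝ (Set.range P.H.col) = LinearMap.ker P.F.mulVecLin) :
    -- the two descriptions of the regret constraint agree
    (∀ (x : Fin n → ℝ) (γ : ℝ),
      P.regretMatrix x γ ∈ RelRobust.copositivityCone P.D ↔
        P.regretMatrix x γ ∈ RelRobust.dualHullCone P.D) ∧
    -- the second-order cone constraint encodes `xᵀ Q x ≤ s`
    (∀ (x : Fin n → ℝ) (s : ℝ),
      P.socVec x s ∈ RelRobust.lorentzCone (Unit ⊕ Fin n) ↔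
        dotProduct x (P.Q.mulVec x) ≤ s) ∧
    -- sufficiency
    (∀ (x : Fin n → ℝ) (γ : ℝ),
      P.System x γ → P.regretMatrix x γ ∈ RelRobust.copositivityCone P.D) ∧
    -- necessity and sufficiency when `mg ∈ {0, 1}`
    (mg = 0 ∨ mg = 1 → P.feasible.Nonempty ∨ (0 < P.lam ∧ P.Q.PosDef) →
      ∀ (x : Fin n → ℝ) (γ : ℝ),
        P.System x γ ↔ P.regretMatrix x γ ∈ RelRobust.copositivityCone P.D) ∧
    -- (ARRP) is a conic problem: its constraint expressions are affine in the variables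
    (∃ A : RelRobust.Data.Var k mg r →ᵃ[ℝ] RelRobust.Data.ConSpace n k mg r,
      ∀ v, A v = P.arrpMap v) ∧
    -- (ARRP) is an inner approximation of the relative robust problem
    (∀ v ∈ P.arrpFeasible,
      P.xp + P.H.mulVec v.1 ∈ P.feasible ∧
        P.maxRegret (P.xp + P.H.mulVec v.1) ≤ (v.2.1 : EReal)) ∧
    P.rrpValue ≤ P.arrpValue ∧
    -- (ARRP) is exact when `mg ∈ {0, 1}`
    (mg = 0 ∨ mg = 1 →
      (∀ (x : Fin n → ℝ) (γ : ℝ),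
        (x ∈ P.feasible ∧ P.maxRegret x ≤ (γ : EReal)) ↔
          ∃ v ∈ P.arrpFeasible, P.xp + P.H.mulVec v.1 = x ∧ v.2.1 = γ) ∧
      P.arrpValue = P.rrpValue) := by
  have hQ : P.Q.IsSymm := by
    rw [hU, Matrix.IsSymm, Matrix.transpose_mul, Matrix.transpose_transpose]
  have hinner : ∀ v ∈ P.arrpFeasible, P.xp + P.H.mulVec v.1 ∈ P.feasible ∧
      P.maxRegret (P.xp + P.H.mulVec v.1) ≤ (v.2.1 : EReal) := by
    intro v hv
    obtain ⟨hx, hsys⟩ := (P.exists_mem_arrpFeasible_iff hxp hHker _ v.2.1).1 ⟨v, hv, rfl, rfl⟩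
    exact ⟨hx, (P.maxRegret_le_iff hQ _ _).2 (P.copositive_of_system hlam hU hQ hxp hHker hsys)⟩
  have hle : P.rrpValue ≤ P.arrpValue :=
    le_iInf₂ fun v hv => (iInf₂_le _ (hinner v hv).1).trans (hinner v hv).2
  have hiff : mg = 0 ∨ mg = 1 → P.feasible.Nonempty ∨ (0 < P.lam ∧ P.Q.PosDef) →
      ∀ (x : Fin n → ℝ) (γ : ℝ),
        P.System x γ ↔ P.regretMatrix x γ ∈ RelRobust.copositivityCone P.D :=
    fun hmg hreg x γ => ⟨P.copositive_of_system hlam hU hQ hxp hHker,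
      P.system_of_copositive hlam hU hQ hxp hH hHker hmg hreg⟩
  have hexact : mg = 0 ∨ mg = 1 → ∀ (x : Fin n → ℝ) (γ : ℝ),
      (x ∈ P.feasible ∧ P.maxRegret x ≤ (γ : EReal)) ↔
        ∃ v ∈ P.arrpFeasible, P.xp + P.H.mulVec v.1 = x ∧ v.2.1 = γ := by
    intro hmg x γ
    rw [P.exists_mem_arrpFeasible_iff hxp hHker, P.maxRegret_le_iff hQ]
    -- The point `x` itself witnesses nonemptiness, so exactness requires no definiteness of `Q`.
    exact and_congr_right fun hx => (hiff hmg (Or.inl ⟨x, hx⟩) x γ).symm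
  refine ⟨fun x γ => RelRobust.mem_copositivityCone_iff_mem_dualHullCone, P.socVec_mem_iff hU,
    fun x γ => P.copositive_of_system hlam hU hQ hxp hHker, hiff, P.exists_affineMap_eq_arrpMap,
    hinner, hle, fun hmg => ⟨hexact hmg, le_antisymm (le_iInf₂ fun x hx => ?_) hle⟩⟩
  -- Comparing with all real `γ` above the regret of `x` also covers infinite regret.
  refine EReal.le_of_forall_lt_iff_le.1 fun γ hγ => ?_
  obtain ⟨v, hv, -, rfl⟩ := (hexact hmg x γ).1 ⟨hx, hγ.le⟩
  exact iInf₂_le v hv
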